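/- **Proposition 2.1.** Let $N\ge 2$, $\mathbb R^N_+=\{x=(x',x_N)\in\mathbb R^{N-1}\times\mathbb R:\ x_N>0\}$, $\rho(x)=x_N$, $\mu_1=-\tfrac{N^2}{4}$ and $\mu\ge\mu_1$. Put $\alpha_\pm=\frac{2-N}{2}\pm\sqrt{\mu-\mu_1}$ and $\psi_1(x)=\frac{x_N}{|x|}$, and for $x\in\mathbb R^N_+$ with $r=|x|$ let $$\gamma_\mu(x)=r^{\alpha_+}\psi_1(x),\qquad \phi_\mu(x)=\begin{cases} r^{\alpha_-}\psi_1(x) & \text{if }\mu>\mu_1,\\ r^{-\frac{N-2}{2}}\ln(r^{-1})\,\psi_1(x)&\text{if }\mu=\mu_1.\end{cases}$$ Write $d\gamma_\mu(x)=\gamma_\mu(x)\,dx$ and $$\mathcal L^*_\mu\zeta=-\Delta\zeta-\frac{2}{\gamma_\mu}\langle\nabla\gamma_\mu,\nabla\zeta\rangle ,$$ understood in the sense of distributions in $\mathbb R^N_+$: a function $g\in L^1_{loc}(\mathbb R^N_+)$ equals $\mathcal L^*_\mu\zeta$ if $$\int_{\mathbb R^N_+}\zeta\Big(-\Delta\xi+2\,\mathrm{div}\big(\tfrac{\xi}{\gamma_\mu}\nabla\gamma_\mu\big)\Big)dx=\int_{\mathbb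 R^N_+} g\,\xi\,dx\qquad\text{for all }\xi\in C_c^\infty(\mathbb R^N_+).$$ Let $$\mathbb X_\mu(\mathbb R^N_+)=\big\{\zeta\in C_c(\overline{\mathbb R^N_+}):\ \mathcal L^*_\mu\zeta\in L^1_{loc}(\mathbb R^N_+)\ \text{and}\ \rho\,\mathcal L^*_\mu\zeta\in L^\infty(\mathbb R^N_+)\big\}.$$ Then $\phi_\mu$ belongs to $L^1_{loc}$ with respect to $\rho^{-1}d\gamma_\mu$, locally up to the boundary, i.e. $\int_{K\cap\mathbb R^N_+}|\phi_\mu|\,\rho^{-1}\,d\gamma_\mu<\infty$ for every compact $K\subset\overline{\mathbb R^N_+}$. Moreover, for every $\zeta\in\mathbb X_\mu(\mathbb R^N_+)$ the function $\phi_\mu\,\mathcal L^*_\mu\zeta$ is $d\gamma_\mu$-integrable on $\mathbb R^N_+$ and $$\int_{\mathbb R^N_+}\phi_\mu\,\mathcal L^*_\mu\zeta\,d\gamma_\mu=c_\mu\,\zeta(0),\qquad c_\mu=\begin{cases}2\sqrt{\mu-\mu_1}\displaystyle\int_{\mathbb S^{N-1}_+}\psi_1^2\,dS&\text{if }\mu>\mu_1,\\[2mm]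 \displaystyle\int_{\mathbb S^{N-1}_+}\psi_1^2\,dS&\text{if }\mu=\mu_1,\end{cases}$$ where $\mathbb S^{N-1}_+=\mathbb S^{N-1}\cap\mathbb R^N_+$ and $dS$ is the surface measure. -/

import Mathlib

open MeasureTheory Set
open scoped ContDiff InnerProductSpace

noncomputable section

/-!
The ambient space is `ℝ^N` with `N = n + 1`, so that the last coordinate `x_N` always exists.
-/

/-- Euclidean space `ℝ^N`, `N = n + 1`. -/
abbrev Space (n : ℕ) : Type := EuclideanSpace ℝ (Fin (n + 1))

/-- The open half-space `ℝ^N_+ = {x | x_N > 0}`. -/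
def halfSpace (n : ℕ) : Set (Space n) := {x | 0 < x (Fin.last n)}

/-- `ρ(x) = x_N`, for `x ∈ ℝ^N_+` the distance from `x` to the boundary of `ℝ^N_+`. -/
def rho (n : ℕ) (x : Space n) : ℝ := x (Fin.last n)

/-- The critical value `μ₁ = -N²/4`. -/
def muOne (n : ℕ) : ℝ := -((n : ℝ) + 1) ^ 2 / 4

/-- `α₊ = (2 - N)/2 + √(μ - μ₁)`. -/
def alphaPlus (n : ℕ) (μ : ℝ) : ℝ := (2 - ((n : ℝ) + 1)) / 2 + √(μ - muOne n)

/-- `α₋ = (2 - N)/2 - √(μ - μ₁)`. -/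
def alphaMinus (n : ℕ) (μ : ℝ) : ℝ := (2 - ((n : ℝ) + 1)) / 2 - √(μ - muOne n)

/-- `ψ₁ = x_N / |x|`. -/
def psiOne (n : ℕ) (x : Space n) : ℝ := x (Fin.last n) / ‖x‖

/-- The regular solution `γ_μ = r^{α₊} ψ₁`, `r = |x|`. -/
def gammaFun (n : ℕ) (μ : ℝ) (x : Space n) : ℝ := ‖x‖ ^ alphaPlus n μ * psiOne n x

open Classical in
/-- The singular solution `φ_μ`: `r^{α₋} ψ₁` if `μ ≠ μ₁` (the case `μ > μ₁`), and
`r^{-(N-2)/2} ln(r⁻¹) ψ₁` if `μ = μ₁`. -/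
def phiFun (n : ℕ) (μ : ℝ) (x : Space n) : ℝ :=
  if μ = muOne n then
    ‖x‖ ^ (-(((n : ℝ) + 1) - 2) / 2) * Real.log ‖x‖⁻¹ * psiOne n x
  else ‖x‖ ^ alphaMinus n μ * psiOne n x

/-- The measure `dγ_μ = γ_μ dx` on `ℝ^N_+`. -/
def gammaMeasure (n : ℕ) (μ : ℝ) : Measure (Space n) :=
  (volume.restrict (halfSpace n)).withDensity fun x => ENNReal.ofReal (gammaFun n μ x)

/-- The measure `ρ⁻¹ dγ_μ` on `ℝ^N_+`. -/
def rhoInvGammaMeasure (n : ℕ) (μ : ℝ) : Measure (Space n) :=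
  (gammaMeasure n μ).withDensity fun x => ENNReal.ofReal (rho n x)⁻¹

/-- The divergence of a vector field on `ℝ^N`. -/
def divergence (n : ℕ) (F : Space n → Space n) (x : Space n) : ℝ :=
  ∑ i, fderiv ℝ (fun y => F y i) x (EuclideanSpace.single i 1)

/-- The `dx`-transpose `ξ ↦ -Δξ + 2 div((ξ / γ_μ) ∇γ_μ)` of the dual operator
`L*_μ ζ = -Δζ - (2 / γ_μ) ⟨∇γ_μ, ∇ζ⟩`. -/
def dualTranspose (n : ℕ) (μ : ℝ) (ξ : Space n → ℝ) (x : Space n) : ℝ :=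
  -Laplacian.laplacian ξ x
    + 2 * divergence n (fun y => (ξ y / gammaFun n μ y) • gradient (gammaFun n μ) y) x

/-- `g = L*_μ ζ` in the sense of distributions in the open half-space, where
`L*_μ ζ = -Δζ - (2 / γ_μ) ⟨∇γ_μ, ∇ζ⟩`. -/
def IsDualOf (n : ℕ) (μ : ℝ) (ζ g : Space n → ℝ) : Prop :=
  LocallyIntegrableOn g (halfSpace n) ∧
  ∀ ξ : Space n → ℝ, ContDiff ℝ ∞ ξ → HasCompactSupport ξ → tsupport ξ ⊆ halfSpace n →
    ∫ x in halfSpace n, ζ x * dualTranspose n μ ξ x = ∫ x in halfSpace n, g x * ξ x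

/-- The test function space `X_μ(ℝ^N_+)`: the continuous functions with compact support on the
closed half-space such that `ρ L*_μ ζ ∈ L^∞(ℝ^N_+)`. The values of `ζ` outside the closed
half-space play no role. -/
def testSpace (n : ℕ) (μ : ℝ) : Set (Space n → ℝ) :=
  {ζ | ContinuousOn ζ (closure (halfSpace n)) ∧
    (∃ K : Set (Space n), IsCompact K ∧ ∀ x ∈ closure (halfSpace n) \ K, ζ x = 0) ∧
    ∃ g : Space n → ℝ, IsDualOf n μ ζ g ∧
      MemLp (fun x => rho n x * g x) ⊤ (volume.restrict (halfSpace n))}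

/-- `∫_{S^{N-1}_+} ψ₁² dS`, with the surface measure on the unit sphere. -/
def psiOneSqIntegral (n : ℕ) : ℝ :=
  ∫ σ in {σ : Metric.sphere (0 : Space n) 1 | (σ : Space n) ∈ halfSpace n},
    psiOne n (σ : Space n) ^ 2 ∂(volume : Measure (Space n)).toSphere

open Classical in
/-- `c_μ = 2 √(μ - μ₁) ∫ ψ₁² dS` if `μ ≠ μ₁` (the case `μ > μ₁`), and `∫ ψ₁² dS` if `μ = μ₁`. -/
def cConst (n : ℕ) (μ : ℝ) : ℝ :=
  if μ = muOne n then psiOneSqIntegral n else 2 * √(μ - muOne n) * psiOneSqIntegral n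

end

noncomputable section

open Filter Topology

/-! Put t = -log |x| and s = √(μ - μ₁). On the half-space the density φ_μ γ_μ equals x_N² |x|^(-N)
(A + B t) with s B = 0 (`exists_phiFun_mul_gammaFun`). On functions x_N² |x|^(-N) y(t) the
transposed operator reduces to an ordinary differential operator: it gives x_N² |x|^(-N-2) (-y'' - 2
s y') (`limitFormula_logProfile`), which annihilates y = A + B t. So the dual equation is tested
with a truncation of φ_μ γ_μ, and only the truncation near the origin leaves a trace.

Truncating by χ(t/T) produces a source supported in T ≤ t ≤ 2T, with integral B + 2 s A and L¹ norm
bounded uniformly in T. In polar coordinates x_N² |x|^(-N-2) dx is ψ₁² dS dt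
(`integral_halfSpace_comp_neg_log`), so the source is a kernel of mass c_μ concentrating at the
origin, and its pairing with the continuous ζ tends to c_μ ζ(0) (`tendsto_integral_log_kernel`). The
other side converges by dominated convergence: one factor x_N makes g bounded, and the remaining x_N
|x|^(-N) |A + B t| is locally integrable.

Two further truncations cost nothing. At the boundary, x_N² is replaced by cutoffs β with |β| ≤ z²,
|β'| ≤ C z, |β''| ≤ C uniformly; this second-order vanishing keeps the transposed expression bounded
despite its 1/z and 1/z² coefficients, so boundedness of ζ suffices (`integral_sq_mul_normSq_eq`).
At infinity, the cutoff acts where ζ vanishes, and there g vanishes too because the operator is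
local (`IsDualOf.ae_eq_zero`). -/

/-- `x_N` as a continuous linear functional. -/
def lastCoord (n : ℕ) : Space n →L[ℝ] ℝ := EuclideanSpace.proj (Fin.last n)

@[simp] theorem lastCoord_apply (n : ℕ) (x : Space n) : lastCoord n x = x (Fin.last n) := rfl

/-! ### Calculus for functions of x_N and |x|². -/

theorem hasFDerivAt_normSq {n : ℕ} (x : Space n) :
    HasFDerivAt (fun y : Space n => ‖y‖ ^ 2) ((2 : ℝ) • innerSL ℝ x) x := by
  refine (hasStrictFDerivAt_norm_sq x).hasFDerivAt.congr_fderiv ?_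
  ext v
  simp

/-- Derivative of a function of `x_N` and `|x|²` in product form. -/
theorem hasFDerivAt_mul_normSq {n : ℕ} {β m : ℝ → ℝ} {b' m' : ℝ} {x : Space n}
    (hβ : HasDerivAt β b' (x (Fin.last n))) (hm : HasDerivAt m m' (‖x‖ ^ 2)) :
    HasFDerivAt (fun y : Space n => β (y (Fin.last n)) * m (‖y‖ ^ 2))
      ((b' * m (‖x‖ ^ 2)) • lastCoord n + (2 * β (x (Fin.last n)) * m') • innerSL ℝ x) x := by
  have h1 : HasFDerivAt (fun y : Space n => β (y (Fin.last n))) (b' • lastCoord n) x :=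
    HasDerivAt.comp_hasFDerivAt x hβ (lastCoord n).hasFDerivAt
  have h2 : HasFDerivAt (fun y : Space n => m (‖y‖ ^ 2)) (m' • ((2 : ℝ) • innerSL ℝ x)) x :=
    HasDerivAt.comp_hasFDerivAt x hm (hasFDerivAt_normSq x)
  refine (h1.mul h2).congr_fderiv ?_
  ext v
  simp only [add_apply, smul_apply, smul_eq_mul]
  ring

/-- `∂_i x_N`. -/
def lastDelta (n : ℕ) (i : Fin (n + 1)) : ℝ := if i = Fin.last n then 1 else 0

theorem lastCoord_single (n : ℕ) (i : Fin (n + 1)) :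
    lastCoord n (EuclideanSpace.single i 1) = lastDelta n i := by
  simp [lastDelta, eq_comm]

theorem innerSL_single {n : ℕ} (x : Space n) (i : Fin (n + 1)) :
    innerSL ℝ x (EuclideanSpace.single i 1) = x i := by
  simp [EuclideanSpace.inner_single_right]

theorem proj_single_self {n : ℕ} (i : Fin (n + 1)) :
    (EuclideanSpace.proj i : Space n →L[ℝ] ℝ) (EuclideanSpace.single i 1) = 1 := by
  simp

theorem sum_lastDelta_mul {n : ℕ} (f : Fin (n + 1) → ℝ) :
    ∑ i, lastDelta n i * f i = f (Fin.last n) := by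
  simp [lastDelta]

theorem sum_coord_mul_self {n : ℕ} (x : Space n) : ∑ i, x i * x i = ‖x‖ ^ 2 := by
  rw [EuclideanSpace.norm_sq_eq]
  simp [sq]

theorem lastDelta_mul_self (n : ℕ) (i : Fin (n + 1)) :
    lastDelta n i * lastDelta n i = lastDelta n i := by
  simp [lastDelta]

theorem fderiv_mul_normSq_single {n : ℕ} {β m : ℝ → ℝ} {b' m' : ℝ} {x : Space n}
    (hβ : HasDerivAt β b' (x (Fin.last n))) (hm : HasDerivAt m m' (‖x‖ ^ 2)) (i : Fin (n + 1)) :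
    fderiv ℝ (fun y : Space n => β (y (Fin.last n)) * m (‖y‖ ^ 2)) x (EuclideanSpace.single i 1)
      = b' * m (‖x‖ ^ 2) * lastDelta n i + 2 * β (x (Fin.last n)) * m' * x i := by
  rw [(hasFDerivAt_mul_normSq hβ hm).fderiv]
  simp only [add_apply, smul_apply, lastCoord_single,
    innerSL_single, smul_eq_mul]

theorem laplacian_eq_sum_fderiv {n : ℕ} {f : Space n → ℝ} (hf : ContDiff ℝ 2 f) (x : Space n) :
    Laplacian.laplacian f x = ∑ i, fderiv ℝ (fun y => fderiv ℝ f y (EuclideanSpace.single i 1)) x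
      (EuclideanSpace.single i 1) := by
  rw [InnerProductSpace.laplacian_eq_iteratedFDeriv_orthonormalBasis f
    (EuclideanSpace.basisFun (Fin (n + 1)) ℝ)]
  refine Finset.sum_congr rfl fun i _ => ?_
  rw [iteratedFDeriv_two_apply]
  have hd : DifferentiableAt ℝ (fderiv ℝ f) x :=
    ((hf.fderiv_right (m := 1) (by norm_num)).differentiable (by norm_num)) x
  rw [fderiv_clm_apply hd (differentiableAt_const _)]
  simp

theorem laplacian_mul_normSq {n : ℕ} {β m : ℝ → ℝ} (hβ : ContDiff ℝ ∞ β) (hm : ContDiff ℝ ∞ m)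
    (x : Space n) :
    Laplacian.laplacian (fun y : Space n => β (y (Fin.last n)) * m (‖y‖ ^ 2)) x =
      deriv (deriv β) (x (Fin.last n)) * m (‖x‖ ^ 2)
        + 4 * x (Fin.last n) * deriv β (x (Fin.last n)) * deriv m (‖x‖ ^ 2)
        + β (x (Fin.last n)) * (4 * ‖x‖ ^ 2 * deriv (deriv m) (‖x‖ ^ 2)
          + 2 * (n + 1) * deriv m (‖x‖ ^ 2)) := by
  have hβ1 : ∀ z, HasDerivAt β (deriv β z) z := fun z =>
    (hβ.differentiable (by simp) z).hasDerivAt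
  have hm1 : ∀ z, HasDerivAt m (deriv m z) z := fun z =>
    (hm.differentiable (by simp) z).hasDerivAt
  have hβ2 : ∀ z, HasDerivAt (deriv β) (deriv (deriv β) z) z := fun z =>
    (((contDiff_infty_iff_deriv.1 hβ).2).differentiable (by simp) z).hasDerivAt
  have hm2 : ∀ z, HasDerivAt (deriv m) (deriv (deriv m) z) z := fun z =>
    (((contDiff_infty_iff_deriv.1 hm).2).differentiable (by simp) z).hasDerivAt
  have hsm : ContDiff ℝ ∞ (fun y : Space n => β (y (Fin.last n)) * m (‖y‖ ^ 2)) :=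
    (hβ.comp (lastCoord n).contDiff).mul (hm.comp (contDiff_norm_sq ℝ))
  rw [laplacian_eq_sum_fderiv (hsm.of_le (by norm_cast))]
  have key : ∀ i : Fin (n + 1),
      fderiv ℝ (fun y => fderiv ℝ (fun y : Space n => β (y (Fin.last n)) * m (‖y‖ ^ 2)) y
        (EuclideanSpace.single i 1)) x (EuclideanSpace.single i 1)
      = lastDelta n i * (deriv (deriv β) (x (Fin.last n)) * m (‖x‖ ^ 2))
        + lastDelta n i * (x i * (4 * deriv β (x (Fin.last n)) * deriv m (‖x‖ ^ 2)))
        + (x i * x i) * (4 * β (x (Fin.last n)) * deriv (deriv m) (‖x‖ ^ 2))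
        + 2 * β (x (Fin.last n)) * deriv m (‖x‖ ^ 2) := by
    intro i
    have e : (fun y => fderiv ℝ (fun y : Space n => β (y (Fin.last n)) * m (‖y‖ ^ 2)) y
        (EuclideanSpace.single i 1)) = fun y : Space n =>
        (deriv β (y (Fin.last n)) * m (‖y‖ ^ 2)) * lastDelta n i
          + 2 * ((β (y (Fin.last n)) * deriv m (‖y‖ ^ 2)) * y i) := by
      funext y
      rw [fderiv_mul_normSq_single (hβ1 _) (hm1 _) i]
      ring
    have h1 := (hasFDerivAt_mul_normSq (x := x) (hβ2 _) (hm1 _)).mul_const (lastDelta n i)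
    have h2 := ((hasFDerivAt_mul_normSq (x := x) (hβ1 _) (hm2 _)).mul
      (EuclideanSpace.proj i : Space n →L[ℝ] ℝ).hasFDerivAt).const_mul 2
    have h3 : HasFDerivAt (fun y : Space n =>
        (deriv β (y (Fin.last n)) * m (‖y‖ ^ 2)) * lastDelta n i
          + 2 * ((β (y (Fin.last n)) * deriv m (‖y‖ ^ 2)) * y i)) _ x := h1.add h2
    rw [e, h3.fderiv]
    simp only [add_apply, smul_apply, lastCoord_single,
      innerSL_single, smul_eq_mul, proj_single_self]
    have := lastDelta_mul_self n i
    have hpr : (EuclideanSpace.proj i : Space n →L[ℝ] ℝ) x = x i := rfl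
    rw [hpr]
    linear_combination (deriv (deriv β) (x (Fin.last n)) * m (‖x‖ ^ 2)) * this
  rw [Finset.sum_congr rfl fun i _ => key i]
  simp only [Finset.sum_add_distrib, ← Finset.sum_mul, sum_coord_mul_self]
  rw [Finset.sum_congr rfl fun i _ => (mul_assoc _ _ _).symm]
  simp only [mul_assoc, sum_lastDelta_mul]
  simp only [Finset.sum_const, Finset.card_univ, Fintype.card_fin]
  have : ∑ i, lastDelta n i = 1 := by simp [lastDelta]
  rw [this, nsmul_eq_mul]
  push_cast
  ring

/-! ### The drift of γ_μ and the transposed operator on product functions. -/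

theorem norm_pos_of_mem_halfSpace {n : ℕ} {x : Space n} (hx : x ∈ halfSpace n) : 0 < ‖x‖ := by
  rw [norm_pos_iff]
  rintro rfl
  simp [halfSpace] at hx

theorem isOpen_halfSpace (n : ℕ) : IsOpen (halfSpace n) :=
  isOpen_lt continuous_const (lastCoord n).continuous

theorem gammaFun_eq {n : ℕ} (μ : ℝ) {x : Space n} (hx : x ∈ halfSpace n) :
    gammaFun n μ x = x (Fin.last n) * (‖x‖ ^ 2) ^ ((alphaPlus n μ - 1) / 2) := by
  have h := norm_pos_of_mem_halfSpace hx
  rw [gammaFun, psiOne, ← Real.rpow_natCast, ← Real.rpow_mul h.le]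
  have : (((2 : ℕ) : ℝ) * ((alphaPlus n μ - 1) / 2)) = alphaPlus n μ - 1 := by push_cast; ring
  rw [this, Real.rpow_sub_one h.ne']
  ring

theorem gammaFun_pos {n : ℕ} (μ : ℝ) {x : Space n} (hx : x ∈ halfSpace n) :
    0 < gammaFun n μ x := by
  have h := norm_pos_of_mem_halfSpace hx
  rw [gammaFun_eq μ hx]
  have : 0 < x (Fin.last n) := hx
  positivity

/-- The coordinates of the drift `∇γ_μ / γ_μ`. -/
theorem gradient_gammaFun_apply {n : ℕ} (μ : ℝ) {x : Space n} (hx : x ∈ halfSpace n)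
    (i : Fin (n + 1)) :
    (gradient (gammaFun n μ) x) i = gammaFun n μ x *
      ((alphaPlus n μ - 1) * x i / ‖x‖ ^ 2 + lastDelta n i / x (Fin.last n)) := by
  have h := norm_pos_of_mem_halfSpace hx
  have hz : 0 < x (Fin.last n) := hx
  have hp : 0 < ‖x‖ ^ 2 := by positivity
  have e : gammaFun n μ =ᶠ[nhds x] fun y : Space n =>
      y (Fin.last n) * (‖y‖ ^ 2) ^ ((alphaPlus n μ - 1) / 2) := by
    filter_upwards [(isOpen_halfSpace n).mem_nhds hx] with y hy using gammaFun_eq μ hy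
  have h1 : (gradient (gammaFun n μ) x) i
      = fderiv ℝ (gammaFun n μ) x (EuclideanSpace.single i 1) := by
    rw [← toDual_gradient, InnerProductSpace.toDual_apply_apply, ← innerSL_apply_apply ℝ,
      innerSL_single]
  rw [h1, e.fderiv_eq, fderiv_mul_normSq_single (β := fun z => z) (hasDerivAt_id _)
    (Real.hasDerivAt_rpow_const (Or.inl hp.ne')), gammaFun_eq μ hx, Real.rpow_sub_one hp.ne']
  field_simp
  ring

/-- `T ξ` for a test function `ξ = β(x_N) m(|x|²)`. -/
def transposeFormula (N a : ℝ) (β m : ℝ → ℝ) (z p : ℝ) : ℝ :=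
  m p * (-deriv (deriv β) z + 2 * deriv β z / z - 2 * β z / z ^ 2 + 2 * a * z * deriv β z / p)
    + deriv m p * (-4 * z * deriv β z + β z * (4 * a + 4 - 2 * N))
    - 4 * p * β z * deriv (deriv m) p + 2 * a * (N - 2) * β z * m p / p

theorem dualTranspose_mul_normSq {n : ℕ} (μ : ℝ) {β m : ℝ → ℝ} (hβ : ContDiff ℝ ∞ β)
    (hm : ContDiff ℝ ∞ m) {x : Space n} (hx : x ∈ halfSpace n) :
    dualTranspose n μ (fun y : Space n => β (y (Fin.last n)) * m (‖y‖ ^ 2)) x =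
      transposeFormula (n + 1) (alphaPlus n μ - 1) β m (x (Fin.last n)) (‖x‖ ^ 2) := by
  have hβ1 : ∀ z, HasDerivAt β (deriv β z) z := fun z =>
    (hβ.differentiable (by simp) z).hasDerivAt
  have hm1 : ∀ z, HasDerivAt m (deriv m z) z := fun z =>
    (hm.differentiable (by simp) z).hasDerivAt
  have h := norm_pos_of_mem_halfSpace hx
  have hz : 0 < x (Fin.last n) := hx
  have hp : 0 < ‖x‖ ^ 2 := by positivity
  set a := alphaPlus n μ - 1 with ha
  set ξ := fun y : Space n => β (y (Fin.last n)) * m (‖y‖ ^ 2) with hξ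
  have key : ∀ i : Fin (n + 1),
      fderiv ℝ (fun y => ((ξ y / gammaFun n μ y) • gradient (gammaFun n μ) y) i) x
        (EuclideanSpace.single i 1)
      = lastDelta n i * (x i * (deriv β (x (Fin.last n)) * m (‖x‖ ^ 2) * a / ‖x‖ ^ 2
          + 2 * β (x (Fin.last n)) * deriv m (‖x‖ ^ 2) / x (Fin.last n)))
        + lastDelta n i * (deriv β (x (Fin.last n)) * m (‖x‖ ^ 2) / x (Fin.last n)
            - β (x (Fin.last n)) * m (‖x‖ ^ 2) / x (Fin.last n) ^ 2)
        + (x i * x i) * (2 * β (x (Fin.last n)) * deriv m (‖x‖ ^ 2) * a / ‖x‖ ^ 2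
            - 2 * β (x (Fin.last n)) * m (‖x‖ ^ 2) * a / (‖x‖ ^ 2) ^ 2)
        + β (x (Fin.last n)) * m (‖x‖ ^ 2) * a / ‖x‖ ^ 2 := by
    intro i
    -- The factor 1 lets the radial weight fit the product rule `hasFDerivAt_mul_normSq` with β = 1.
    have e : (fun y => ((ξ y / gammaFun n μ y) • gradient (gammaFun n μ) y) i) =ᶠ[nhds x]
        fun y : Space n => ξ y * (a * (y i * (1 * (‖y‖ ^ 2)⁻¹))
          + lastDelta n i * (y (Fin.last n))⁻¹) := by
      filter_upwards [(isOpen_halfSpace n).mem_nhds hx] with y hy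
      have := gammaFun_pos μ hy
      rw [PiLp.smul_apply, gradient_gammaFun_apply μ hy, smul_eq_mul]
      field_simp
      ring
    have h1 := hasFDerivAt_mul_normSq (x := x) (hβ1 _) (hm1 _)
    have h2 := hasFDerivAt_mul_normSq (x := x) (β := fun _ => 1) (m := fun t => t⁻¹)
      (hasDerivAt_const _ _) (hasDerivAt_inv hp.ne')
    have h3 : HasFDerivAt (fun y : Space n => (y (Fin.last n))⁻¹) _ x :=
      HasDerivAt.comp_hasFDerivAt x (hasDerivAt_inv hz.ne') (lastCoord n).hasFDerivAt
    have h4 : HasFDerivAt (fun y : Space n => y i) _ x :=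
      (EuclideanSpace.proj i : Space n →L[ℝ] ℝ).hasFDerivAt
    have h5 := h1.mul (((h4.mul h2).const_mul a).add (h3.const_mul (lastDelta n i)))
    have h6 : HasFDerivAt (fun y : Space n => ξ y * (a * (y i * (1 * (‖y‖ ^ 2)⁻¹))
          + lastDelta n i * (y (Fin.last n))⁻¹)) _ x := h5
    rw [e.fderiv_eq, h6.fderiv]
    simp only [add_apply, smul_apply, lastCoord_single,
      innerSL_single, smul_eq_mul, proj_single_self, Pi.add_apply,
      Pi.mul_apply]
    have := lastDelta_mul_self n i
    field_simp
    linear_combination (x (Fin.last n) * deriv β (x (Fin.last n)) * m (‖x‖ ^ 2) * ‖x‖ ^ 4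
      - β (x (Fin.last n)) * m (‖x‖ ^ 2) * ‖x‖ ^ 4) * this
  rw [dualTranspose, laplacian_mul_normSq hβ hm, divergence, Finset.sum_congr rfl fun i _ => key i]
  simp only [Finset.sum_add_distrib, sum_lastDelta_mul, ← Finset.sum_mul, sum_coord_mul_self]
  have : ∑ i, lastDelta n i = 1 := by simp [lastDelta]
  simp only [this, Finset.sum_const, Finset.card_univ, Fintype.card_fin, nsmul_eq_mul,
    transposeFormula]
  push_cast
  field_simp
  ring

theorem dualTranspose_eq_zero {n : ℕ} (μ : ℝ) {ξ : Space n → ℝ} {x : Space n}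
    (hx : x ∉ tsupport ξ) : dualTranspose n μ ξ x = 0 := by
  have h0 : ξ =ᶠ[nhds x] fun _ => 0 := notMem_tsupport_iff_eventuallyEq.1 hx
  have h1 : Laplacian.laplacian ξ x = 0 := by
    rw [InnerProductSpace.laplacian_congr_nhds h0 |>.eq_of_nhds]
    simp
  have h2 : divergence n (fun y => (ξ y / gammaFun n μ y) • gradient (gammaFun n μ) y) x = 0 := by
    refine Finset.sum_eq_zero fun i _ => ?_
    have : (fun y => ((ξ y / gammaFun n μ y) • gradient (gammaFun n μ) y) i) =ᶠ[nhds x]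
        fun _ => 0 := by
      filter_upwards [h0] with y hy
      simp [hy]
    rw [this.fderiv_eq]
    simp
  rw [dualTranspose, h1, h2]
  simp

/-! ### Cutoffs of z² near the boundary, with bounds uniform in the scale. -/

/-- `τ² b(τ)` with a smooth cutoff `b` vanishing on `τ ≤ 1` and equal to `1` on `τ ≥ 2`. -/
def squareCutoff (τ : ℝ) : ℝ := τ ^ 2 * Real.smoothTransition (τ - 1)

theorem contDiff_squareCutoff : ContDiff ℝ ∞ squareCutoff := by
  unfold squareCutoff
  exact (contDiff_id.pow 2).mul (Real.smoothTransition.contDiff.comp (contDiff_id.sub contDiff_const))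

theorem squareCutoff_of_le_one {τ : ℝ} (h : τ ≤ 1) : squareCutoff τ = 0 := by
  rw [squareCutoff, Real.smoothTransition.zero_of_nonpos (by linarith), mul_zero]

theorem squareCutoff_of_two_le {τ : ℝ} (h : 2 ≤ τ) : squareCutoff τ = τ ^ 2 := by
  rw [squareCutoff, Real.smoothTransition.one_of_one_le (by linarith), mul_one]

theorem abs_squareCutoff_le (τ : ℝ) : |squareCutoff τ| ≤ τ ^ 2 := by
  rw [squareCutoff, abs_mul, abs_of_nonneg (sq_nonneg τ),
    abs_of_nonneg (Real.smoothTransition.nonneg _)]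
  exact mul_le_of_le_one_right (sq_nonneg _) (Real.smoothTransition.le_one _)

theorem deriv_squareCutoff_of_lt_one {τ : ℝ} (h : τ < 1) : deriv squareCutoff τ = 0 := by
  have : squareCutoff =ᶠ[𝓝 τ] fun _ => 0 := by
    filter_upwards [Iio_mem_nhds h] with t ht using squareCutoff_of_le_one (le_of_lt ht)
  rw [this.deriv_eq]
  simp

theorem deriv_squareCutoff_of_two_lt {τ : ℝ} (h : 2 < τ) : deriv squareCutoff τ = 2 * τ := by
  have : squareCutoff =ᶠ[𝓝 τ] fun t => t ^ 2 := by
    filter_upwards [Ioi_mem_nhds h] with t ht using squareCutoff_of_two_le (le_of_lt ht)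
  rw [this.deriv_eq]
  simp

theorem deriv_deriv_squareCutoff_of_lt_one {τ : ℝ} (h : τ < 1) :
    deriv (deriv squareCutoff) τ = 0 := by
  have : deriv squareCutoff =ᶠ[𝓝 τ] fun _ => 0 := by
    filter_upwards [Iio_mem_nhds h] with t ht using deriv_squareCutoff_of_lt_one ht
  rw [this.deriv_eq]
  simp

theorem deriv_deriv_squareCutoff_of_two_lt {τ : ℝ} (h : 2 < τ) :
    deriv (deriv squareCutoff) τ = 2 := by
  have : deriv squareCutoff =ᶠ[𝓝 τ] fun t => 2 * t := by
    filter_upwards [Ioi_mem_nhds h] with t ht using deriv_squareCutoff_of_two_lt ht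
  rw [this.deriv_eq]
  simp

theorem contDiff_deriv_squareCutoff : ContDiff ℝ ∞ (deriv squareCutoff) :=
  (contDiff_infty_iff_deriv.1 contDiff_squareCutoff).2

theorem contDiff_deriv_deriv_squareCutoff : ContDiff ℝ ∞ (deriv (deriv squareCutoff)) :=
  (contDiff_infty_iff_deriv.1 contDiff_deriv_squareCutoff).2

theorem exists_bound_squareCutoff : ∃ C : ℝ, 0 ≤ C ∧
    (∀ τ, |deriv (deriv squareCutoff) τ| ≤ C) ∧ ∀ τ, |deriv squareCutoff τ| ≤ C * |τ| := by
  -- Any compact interval around the transition zone [1, 2] serves; outside that zone the second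
  -- derivative is 0 or 2.
  obtain ⟨C₀, hC₀⟩ := (isCompact_Icc (a := (0 : ℝ)) (b := 3)).exists_bound_of_continuousOn
    contDiff_deriv_deriv_squareCutoff.continuous.continuousOn
  have h2 : ∀ τ, ‖deriv (deriv squareCutoff) τ‖ ≤ max C₀ 2 := by
    intro τ
    rcases lt_or_ge τ 1 with h | h
    · rw [deriv_deriv_squareCutoff_of_lt_one h, norm_zero]
      exact le_max_of_le_right (by norm_num)
    · rcases lt_or_ge 2 τ with h' | h'
      · rw [deriv_deriv_squareCutoff_of_two_lt h']
        simp
      · exact le_max_of_le_left (hC₀ τ ⟨by linarith, by linarith⟩)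
  refine ⟨max C₀ 2, le_max_of_le_right (by norm_num), h2, fun τ => ?_⟩
  -- The mean value inequality from 0, where the first derivative vanishes, turns the bound on the
  -- second derivative into a linear bound on the first.
  have := convex_univ.norm_image_sub_le_of_norm_deriv_le (f := deriv squareCutoff)
    (C := max C₀ 2)
    (fun x _ => (contDiff_deriv_squareCutoff.differentiable (by simp)) x)
    (fun x _ => h2 x) (mem_univ 0) (mem_univ τ)
  rwa [deriv_squareCutoff_of_lt_one zero_lt_one, sub_zero, sub_zero] at this

/-- The smooth approximation `K⁻² B(K z)` of `z²` vanishing on `z ≤ 1 / K`. -/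
def scaledCutoff (K z : ℝ) : ℝ := K⁻¹ ^ 2 * squareCutoff (K * z)

theorem contDiff_scaledCutoff (K : ℝ) : ContDiff ℝ ∞ (scaledCutoff K) :=
  contDiff_const.mul (contDiff_squareCutoff.comp (contDiff_const.mul contDiff_id))

theorem deriv_scaledCutoff {K : ℝ} (hK : K ≠ 0) :
    deriv (scaledCutoff K) = fun z => K⁻¹ * deriv squareCutoff (K * z) := by
  funext z
  have h := ((contDiff_squareCutoff.differentiable (by simp)) (K * z)).hasDerivAt
  have h1 : HasDerivAt (fun z : ℝ => K * z) K z := by simpa using (hasDerivAt_id z).const_mul K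
  have h2 : HasDerivAt (scaledCutoff K) _ z := (h.comp z h1).const_mul (K⁻¹ ^ 2)
  rw [h2.deriv]
  field_simp

theorem deriv_deriv_scaledCutoff {K : ℝ} (hK : K ≠ 0) :
    deriv (deriv (scaledCutoff K)) = fun z => deriv (deriv squareCutoff) (K * z) := by
  rw [deriv_scaledCutoff hK]
  funext z
  have h := ((contDiff_deriv_squareCutoff.differentiable (by simp)) (K * z)).hasDerivAt
  have h1 : HasDerivAt (fun z : ℝ => K * z) K z := by simpa using (hasDerivAt_id z).const_mul K
  have h2 : HasDerivAt (fun z => K⁻¹ * deriv squareCutoff (K * z)) _ z :=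
    (h.comp z h1).const_mul K⁻¹
  rw [h2.deriv]
  field_simp

theorem abs_scaledCutoff_le {K : ℝ} (hK : 0 < K) (z : ℝ) : |scaledCutoff K z| ≤ z ^ 2 := by
  rw [scaledCutoff, abs_mul, abs_of_nonneg (sq_nonneg _)]
  calc K⁻¹ ^ 2 * |squareCutoff (K * z)| ≤ K⁻¹ ^ 2 * (K * z) ^ 2 := by
        gcongr; exact abs_squareCutoff_le _
    _ = z ^ 2 := by field_simp

theorem abs_deriv_scaledCutoff_le {C : ℝ} (hC : ∀ τ, |deriv squareCutoff τ| ≤ C * |τ|) {K : ℝ}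
    (hK : 0 < K) (z : ℝ) : |deriv (scaledCutoff K) z| ≤ C * |z| := by
  rw [deriv_scaledCutoff hK.ne', abs_mul, abs_of_pos (inv_pos.2 hK)]
  calc K⁻¹ * |deriv squareCutoff (K * z)| ≤ K⁻¹ * (C * |K * z|) := by gcongr; exact hC _
    _ = C * |z| := by rw [abs_mul, abs_of_pos hK]; field_simp

/-- Limit of `transposeFormula` as `β` tends to `z²`. -/
def limitFormula (N a : ℝ) (m : ℝ → ℝ) (p : ℝ) : ℝ :=
  -4 * p * deriv (deriv m) p + (4 * a - 2 * N - 4) * deriv m p + 2 * a * N * m p / p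

/-- Here β = z² near z, and the terms -β'' + 2β'/z - 2β/z² cancel as -2 + 4 - 2 = 0; every remaining
term carries a factor z². -/
theorem transposeFormula_scaledCutoff {N a K z p : ℝ} {m : ℝ → ℝ} (hK : 0 < K) (hz : 0 < z)
    (hp : 0 < p) (h : 2 < K * z) :
    transposeFormula N a (scaledCutoff K) m z p = z ^ 2 * limitFormula N a m p := by
  rw [transposeFormula, deriv_deriv_scaledCutoff hK.ne', deriv_scaledCutoff hK.ne', scaledCutoff,
    squareCutoff_of_two_le h.le, limitFormula]
  simp only [deriv_deriv_squareCutoff_of_two_lt h, deriv_squareCutoff_of_two_lt h]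
  field_simp
  ring

/-- Dominating function for `transposeFormula`, uniform in the boundary cutoff. -/
def transposeBound (N a C : ℝ) (m : ℝ → ℝ) (p : ℝ) : ℝ :=
  (3 * C + 2 + 2 * |a| * C + 2 * |a| * |N - 2|) * |m p|
    + (4 * C + |4 * a + 4 - 2 * N|) * |p * deriv m p| + 4 * |p ^ 2 * deriv (deriv m) p|

theorem abs_transposeFormula_le {N a C z p : ℝ} {m β : ℝ → ℝ} (hz : 0 < z)
    (hp : z ^ 2 ≤ p) (h0 : |β z| ≤ z ^ 2) (h1 : |deriv β z| ≤ C * |z|)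
    (h2 : |deriv (deriv β) z| ≤ C) :
    |transposeFormula N a β m z p| ≤ transposeBound N a C m p := by
  have hp0 : 0 < p := lt_of_lt_of_le (by positivity) hp
  -- Write β = z² t, β' = z d and z² = p u with t, d, u bounded: all negative powers of z cancel,
  -- and those of p are absorbed by u, leaving a polynomial in bounded quantities.
  obtain ⟨t, ht, hβ⟩ : ∃ t, |t| ≤ 1 ∧ β z = z ^ 2 * t := by
    refine ⟨β z / z ^ 2, ?_, by field_simp⟩
    rw [abs_div, abs_of_pos (by positivity : 0 < z ^ 2)]
    exact div_le_one_of_le₀ h0 (by positivity)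
  obtain ⟨d, hd, hβ'⟩ : ∃ d, |d| ≤ C ∧ deriv β z = z * d := by
    refine ⟨deriv β z / z, ?_, by field_simp⟩
    rw [abs_div, div_le_iff₀ (abs_pos.2 hz.ne')]
    exact h1
  obtain ⟨u, hu, hzu⟩ : ∃ u, |u| ≤ 1 ∧ z ^ 2 = p * u := by
    refine ⟨z ^ 2 / p, ?_, by field_simp⟩
    rw [abs_of_nonneg (by positivity)]
    exact div_le_one_of_le₀ hp hp0.le
  have e : transposeFormula N a β m z p =
      m p * (-deriv (deriv β) z + 2 * d - 2 * t + 2 * a * (u * d) + 2 * a * (N - 2) * (u * t))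
      + p * deriv m p * (-4 * (u * d) + (4 * a + 4 - 2 * N) * (u * t))
      - 4 * (p ^ 2 * deriv (deriv m) p) * (u * t) := by
    rw [transposeFormula, hβ, hβ', show m p * (-deriv (deriv β) z + 2 * (z * d) / z
      - 2 * (z ^ 2 * t) / z ^ 2 + 2 * a * z * (z * d) / p)
      + deriv m p * (-4 * z * (z * d) + z ^ 2 * t * (4 * a + 4 - 2 * N))
      - 4 * p * (z ^ 2 * t) * deriv (deriv m) p + 2 * a * (N - 2) * (z ^ 2 * t) * m p / p
      = m p * (-deriv (deriv β) z + 2 * d - 2 * t + 2 * a * (z ^ 2 * d) / p)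
      + deriv m p * (-4 * (z ^ 2 * d) + z ^ 2 * t * (4 * a + 4 - 2 * N))
      - 4 * p * (z ^ 2 * t) * deriv (deriv m) p + 2 * a * (N - 2) * (z ^ 2 * t) * m p / p by
        field_simp, hzu]
    field_simp
    ring
  have hut : |u * t| ≤ 1 := by
    rw [abs_mul]; exact mul_le_one₀ hu (abs_nonneg _) ht
  have hud : |u * d| ≤ C := by
    rw [abs_mul]
    exact (mul_le_of_le_one_left (abs_nonneg _) hu).trans hd
  have b1 : |-deriv (deriv β) z + 2 * d - 2 * t + 2 * a * (u * d) + 2 * a * (N - 2) * (u * t)|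
      ≤ 3 * C + 2 + 2 * |a| * C + 2 * |a| * |N - 2| := by
    calc _ ≤ |-deriv (deriv β) z| + |2 * d| + |2 * t| + |2 * a * (u * d)|
          + |2 * a * (N - 2) * (u * t)| := by
          refine (abs_add_le _ _).trans ?_
          gcongr
          refine (abs_add_le _ _).trans ?_
          gcongr
          refine (abs_sub _ _).trans ?_
          gcongr
          exact abs_add_le _ _
      _ = |deriv (deriv β) z| + 2 * |d| + 2 * |t| + 2 * |a| * |u * d|
          + 2 * |a| * |N - 2| * |u * t| := by
          rw [abs_neg, abs_mul 2 d, abs_mul 2 t, abs_mul (2 * a) (u * d), abs_mul 2 a,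
            abs_mul (2 * a * (N - 2)), abs_mul (2 * a), abs_mul 2 a, abs_two]
      _ ≤ C + 2 * C + 2 * 1 + 2 * |a| * C + 2 * |a| * |N - 2| * 1 := by gcongr
      _ = _ := by ring
  have b2 : |-4 * (u * d) + (4 * a + 4 - 2 * N) * (u * t)| ≤ 4 * C + |4 * a + 4 - 2 * N| := by
    calc _ ≤ |-4 * (u * d)| + |(4 * a + 4 - 2 * N) * (u * t)| := abs_add_le _ _
      _ = 4 * |u * d| + |4 * a + 4 - 2 * N| * |u * t| := by
          rw [abs_mul (-4), abs_mul (4 * a + 4 - 2 * N)]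
          norm_num
      _ ≤ 4 * C + |4 * a + 4 - 2 * N| * 1 := by gcongr
      _ = _ := by ring
  rw [e, transposeBound]
  refine (abs_sub _ _).trans ?_
  refine add_le_add ((abs_add_le _ _).trans (add_le_add ?_ ?_)) ?_
  · rw [abs_mul, mul_comm]
    gcongr
  · rw [abs_mul, mul_comm]
    gcongr
  · rw [abs_mul, abs_mul 4, abs_of_pos (four_pos : (0 : ℝ) < 4)]
    exact mul_le_of_le_one_right (by positivity) hut

/-! ### Test functions that reach the boundary. -/

theorem hasCompactSupport_comp_normSq {n : ℕ} {m : ℝ → ℝ} (hm : HasCompactSupport m) :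
    HasCompactSupport fun x : Space n => m (‖x‖ ^ 2) := by
  obtain ⟨R, hR⟩ := hm.isCompact.isBounded.subset_closedBall 0
  -- The radius R + 1 avoids a square root: ‖x‖² ≤ R forces ‖x‖ ≤ R + 1.
  refine HasCompactSupport.intro (isCompact_closedBall (0 : Space n) (R + 1)) fun x hx => ?_
  by_contra h
  have h1 := hR (subset_tsupport _ h)
  simp only [Metric.mem_closedBall, dist_zero_right, Real.norm_eq_abs, abs_pow, abs_norm,
    not_le] at h1 hx
  nlinarith [sq_nonneg ‖x‖, norm_nonneg x, sq_nonneg (‖x‖ - 1)]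

theorem sq_last_le_normSq {n : ℕ} (x : Space n) : x (Fin.last n) ^ 2 ≤ ‖x‖ ^ 2 := by
  rw [EuclideanSpace.norm_sq_eq]
  have := Finset.single_le_sum (f := fun i => ‖x i‖ ^ 2) (fun i _ => by positivity)
    (Finset.mem_univ (Fin.last n))
  simpa using this

theorem last_le_norm {n : ℕ} (x : Space n) : x (Fin.last n) ≤ ‖x‖ :=
  (le_abs_self _).trans (abs_le_of_sq_le_sq (sq_last_le_normSq x) (norm_nonneg x))

/-- Testing the dual equation with `x_N² m(|x|²)`, which need not vanish near the boundary. -/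
theorem integral_sq_mul_normSq_eq {n : ℕ} {μ : ℝ} {ζ g : Space n → ℝ} {Z G : ℝ}
    (hζ : ContinuousOn ζ (halfSpace n)) (hZ : ∀ x ∈ halfSpace n, |ζ x| ≤ Z)
    (hg : IsDualOf n μ ζ g)
    (hG : ∀ᵐ x ∂(volume.restrict (halfSpace n)), |rho n x * g x| ≤ G)
    {m : ℝ → ℝ} (hm : ContDiff ℝ ∞ m) (hmc : HasCompactSupport m) :
    ∫ x in halfSpace n, g x * (x (Fin.last n) ^ 2 * m (‖x‖ ^ 2)) =
      ∫ x in halfSpace n, ζ x * (x (Fin.last n) ^ 2 *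
        limitFormula (n + 1) (alphaPlus n μ - 1) m (‖x‖ ^ 2)) := by
  obtain ⟨C, hC, hC2, hC1⟩ := exists_bound_squareCutoff
  have hHm : MeasurableSet (halfSpace n) := (isOpen_halfSpace n).measurableSet
  set a := alphaPlus n μ - 1 with ha
  let K : ℕ → ℝ := fun k => k + 1
  have hK : ∀ k, 0 < K k := fun k => by positivity
  have hm1 : ContDiff ℝ ∞ (deriv m) := (contDiff_infty_iff_deriv.1 hm).2
  have hm2 : ContDiff ℝ ∞ (deriv (deriv m)) := (contDiff_infty_iff_deriv.1 hm1).2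
  have hcN : Continuous fun x : Space n => x (Fin.last n) := (lastCoord n).continuous
  have hc0 : Continuous fun x : Space n => m (‖x‖ ^ 2) :=
    hm.continuous.comp (continuous_norm.pow 2)
  have hc1 : Continuous fun x : Space n => deriv m (‖x‖ ^ 2) :=
    hm1.continuous.comp (continuous_norm.pow 2)
  have hc2 : Continuous fun x : Space n => deriv (deriv m) (‖x‖ ^ 2) :=
    hm2.continuous.comp (continuous_norm.pow 2)
  -- At a fixed interior point the cutoff is eventually inactive, so both pointwise limits below are
  -- eventual equalities.
  have hev : ∀ x ∈ halfSpace n, ∀ᶠ k : ℕ in atTop, 2 < K k * x (Fin.last n) := by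
    intro x hx
    have : Tendsto (fun k : ℕ => K k * x (Fin.last n)) atTop atTop :=
      (tendsto_atTop_add_const_right _ 1 tendsto_natCast_atTop_atTop).atTop_mul_const hx
    exact this.eventually_gt_atTop 2
  have hk : ∀ k : ℕ,
      ∫ x in halfSpace n, ζ x * transposeFormula (n + 1) a (scaledCutoff (K k)) m
        (x (Fin.last n)) (‖x‖ ^ 2)
      = ∫ x in halfSpace n, g x * (scaledCutoff (K k) (x (Fin.last n)) * m (‖x‖ ^ 2)) := by
    intro k
    have hsm : ContDiff ℝ ∞ (fun y : Space n => scaledCutoff (K k) (y (Fin.last n))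
        * m (‖y‖ ^ 2)) :=
      ((contDiff_scaledCutoff (K k)).comp (lastCoord n).contDiff).mul
        (hm.comp (contDiff_norm_sq ℝ))
    rw [← hg.2 _ hsm (hasCompactSupport_comp_normSq hmc).mul_left ?_]
    · exact setIntegral_congr_fun hHm fun x hx => by
        simp only [dualTranspose_mul_normSq μ (contDiff_scaledCutoff (K k)) hm hx, ha]
    · have hcl : IsClosed {x : Space n | 1 ≤ K k * x (Fin.last n)} :=
        isClosed_le continuous_const (continuous_const.mul hcN)
      -- The test function is supported in the closed set K x_N ≥ 1, which stays away from the
      -- boundary.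
      refine (closure_minimal (fun x hx => ?_) hcl).trans fun x hx => ?_
      · by_contra h
        apply hx
        simp only [mem_ofPred_eq, not_le] at h
        simp [scaledCutoff, squareCutoff_of_le_one h.le]
      · have : 0 < K k * x (Fin.last n) := lt_of_lt_of_le one_pos hx
        exact (mul_pos_iff_of_pos_left (hK k)).1 this
  have hgm : AEStronglyMeasurable g (volume.restrict (halfSpace n)) := hg.1.aestronglyMeasurable
  have hζm : AEStronglyMeasurable ζ (volume.restrict (halfSpace n)) :=
    hζ.aestronglyMeasurable hHm
  have hL : Tendsto (fun k : ℕ => ∫ x in halfSpace n,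
      g x * (scaledCutoff (K k) (x (Fin.last n)) * m (‖x‖ ^ 2))) atTop
      (𝓝 (∫ x in halfSpace n, g x * (x (Fin.last n) ^ 2 * m (‖x‖ ^ 2)))) := by
    -- Of the two factors x_N in x_N², one pays for the boundary growth of g and the other is
    -- bounded by |x|.
    refine tendsto_integral_of_dominated_convergence
      (fun x => G * (‖x‖ * |m (‖x‖ ^ 2)|)) (fun k => ?_) ?_ (fun k => ?_) ?_
    · exact hgm.mul ((((contDiff_scaledCutoff (K k)).continuous.comp hcN).mul
        hc0).aestronglyMeasurable)
    · refine Integrable.integrableOn (Continuous.integrable_of_hasCompactSupport ?_ ?_)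
      · fun_prop
      · exact ((hasCompactSupport_comp_normSq hmc).abs.mul_left).mul_left
    · filter_upwards [hG, ae_restrict_mem hHm] with x hGx hx
      have hz : 0 < x (Fin.last n) := hx
      have hGx' : x (Fin.last n) * |g x| ≤ G := by
        rwa [abs_mul, rho, abs_of_pos hz] at hGx
      rw [Real.norm_eq_abs, abs_mul, abs_mul]
      calc |g x| * (|scaledCutoff (K k) (x (Fin.last n))| * |m (‖x‖ ^ 2)|)
          ≤ |g x| * (x (Fin.last n) ^ 2 * |m (‖x‖ ^ 2)|) := by
            gcongr; exact abs_scaledCutoff_le (hK k) _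
        _ = (x (Fin.last n) * |g x|) * (x (Fin.last n) * |m (‖x‖ ^ 2)|) := by ring
        _ ≤ G * (‖x‖ * |m (‖x‖ ^ 2)|) := by
            gcongr
            · exact (by positivity : 0 ≤ x (Fin.last n) * |g x|).trans hGx'
            · exact last_le_norm x
    · filter_upwards [ae_restrict_mem hHm] with x hx
      refine tendsto_const_nhds.congr' ?_
      filter_upwards [hev x hx] with k hkx
      have := (hK k).ne'
      rw [scaledCutoff, squareCutoff_of_two_le hkx.le]
      field_simp
  have hR : Tendsto (fun k : ℕ => ∫ x in halfSpace n, ζ x * transposeFormula (n + 1) a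
      (scaledCutoff (K k)) m (x (Fin.last n)) (‖x‖ ^ 2)) atTop
      (𝓝 (∫ x in halfSpace n, ζ x * (x (Fin.last n) ^ 2 *
        limitFormula (n + 1) a m (‖x‖ ^ 2)))) := by
    refine tendsto_integral_of_dominated_convergence
      (fun x => Z * transposeBound (n + 1) a C m (‖x‖ ^ 2)) (fun k => ?_) ?_ (fun k => ?_) ?_
    · refine hζm.mul (ContinuousOn.aestronglyMeasurable ?_ hHm)
      have hk0 := (contDiff_scaledCutoff (K k)).continuous.comp hcN
      have hk1' := (contDiff_infty_iff_deriv.1 (contDiff_scaledCutoff (K k))).2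
      have hk1 := hk1'.continuous.comp hcN
      have hk2 := (contDiff_infty_iff_deriv.1 hk1').2.continuous.comp hcN
      simp only [Function.comp_def] at hk0 hk1 hk2
      unfold transposeFormula
      have hz : ∀ x ∈ halfSpace n, x (Fin.last n) ≠ 0 := fun x hx => ne_of_gt hx
      have hp : ∀ x ∈ halfSpace n, ‖x‖ ^ 2 ≠ 0 := fun x hx =>
        (pow_pos (norm_pos_of_mem_halfSpace hx) 2).ne'
      have hz2 : ∀ x ∈ halfSpace n, x (Fin.last n) ^ 2 ≠ 0 := fun x hx => pow_ne_zero 2 (hz x hx)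
      have c0 := hk0.continuousOn (s := halfSpace n)
      have c1 := hk1.continuousOn (s := halfSpace n)
      have c2 := hk2.continuousOn (s := halfSpace n)
      have c3 := hc0.continuousOn (s := halfSpace n)
      have c4 := hc1.continuousOn (s := halfSpace n)
      have c5 := hc2.continuousOn (s := halfSpace n)
      have c6 := hcN.continuousOn (s := halfSpace n)
      have cp : ContinuousOn (fun x : Space n => ‖x‖ ^ 2) (halfSpace n) := by fun_prop
      have cc : ∀ r : ℝ, ContinuousOn (fun _ : Space n => r) (halfSpace n) :=
        fun r => continuousOn_const
      exact (((c3.mul (((c2.neg.add (((cc 2).mul c1).div c6 hz)).sub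
        (((cc 2).mul c0).div (c6.pow 2) hz2)).add
        (((((cc 2).mul (cc a)).mul c6).mul c1).div cp hp))).add
        (c4.mul ((((cc (-4)).mul c6).mul c1).add (c0.mul (cc _))))).sub
        ((((cc 4).mul cp).mul c0).mul c5)).add (((((cc _)).mul c0).mul c3).div cp hp)
    · have hs1 := hasCompactSupport_comp_normSq (n := n) hmc
      have hs2 := hasCompactSupport_comp_normSq (n := n) hmc.deriv
      have hs3 := hasCompactSupport_comp_normSq (n := n) hmc.deriv.deriv
      refine Integrable.integrableOn (Continuous.integrable_of_hasCompactSupport ?_ ?_)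
      · unfold transposeBound
        fun_prop
      · refine HasCompactSupport.mul_left (f := fun _ => Z) ?_
        exact (hs1.abs.mul_left.add hs2.mul_left.abs.mul_left).add hs3.mul_left.abs.mul_left
    · filter_upwards [ae_restrict_mem hHm] with x hx
      rw [Real.norm_eq_abs, abs_mul]
      have hb := abs_transposeFormula_le (N := n + 1) (a := a) (m := m) hx (sq_last_le_normSq x)
        (abs_scaledCutoff_le (hK k) _) (abs_deriv_scaledCutoff_le hC1 (hK k) _)
        (by rw [deriv_deriv_scaledCutoff (hK k).ne']; exact hC2 _)
      exact mul_le_mul (hZ x hx) hb (abs_nonneg _) ((abs_nonneg _).trans (hZ x hx))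
    · filter_upwards [ae_restrict_mem hHm] with x hx
      refine tendsto_const_nhds.congr' ?_
      filter_upwards [hev x hx] with k hkx
      rw [transposeFormula_scaledCutoff (hK k) hx (pow_pos (norm_pos_of_mem_halfSpace hx) 2) hkx]
  refine tendsto_nhds_unique hL ?_
  simpa only [hk] using hR

/-! ### Radial profiles in the logarithmic variable t = -log |x|. -/

theorem hasDerivAt_rpow_mul_comp_log {k p : ℝ} {y : ℝ → ℝ} (hp : 0 < p)
    (hy : DifferentiableAt ℝ y (-Real.log p / 2)) :
    HasDerivAt (fun q => q ^ k * y (-Real.log q / 2))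
      (p ^ (k - 1) * (k * y (-Real.log p / 2) - deriv y (-Real.log p / 2) / 2)) p := by
  have h1 : HasDerivAt (fun q : ℝ => -Real.log q / 2) (-p⁻¹ / 2) p :=
    (Real.hasDerivAt_log hp.ne').neg.div_const 2
  have h2 := (Real.hasDerivAt_rpow_const (p := k) (Or.inl hp.ne')).mul
    (HasDerivAt.comp p hy.hasDerivAt h1)
  refine h2.congr_deriv ?_
  rw [Real.rpow_sub_one hp.ne']
  simp only [Function.comp]
  field_simp
  ring

/-- The profile `p ↦ p^(-N/2) y(-log p / 2)`, extended by zero to `p ≤ 0`; at `p = r²` it is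
`r^(-N) y(-log r)`. -/
def logProfile (N : ℝ) (y : ℝ → ℝ) (p : ℝ) : ℝ :=
  if 0 < p then p ^ (-N / 2) * y (-Real.log p / 2) else 0

theorem logProfile_of_pos {N p : ℝ} {y : ℝ → ℝ} (hp : 0 < p) :
    logProfile N y p = p ^ (-N / 2) * y (-Real.log p / 2) := if_pos hp

theorem logProfile_eventuallyEq {N p : ℝ} {y : ℝ → ℝ} (hp : 0 < p) :
    logProfile N y =ᶠ[𝓝 p] fun q => q ^ (-N / 2) * y (-Real.log q / 2) := by
  filter_upwards [Ioi_mem_nhds hp] with q hq using logProfile_of_pos hq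

theorem exists_support_bound_logProfile {y : ℝ → ℝ} (hy : HasCompactSupport y) :
    ∃ c C : ℝ, 0 < c ∧ ∀ N p, logProfile N y p ≠ 0 → p ∈ Icc c C := by
  obtain ⟨R, hR⟩ := hy.isCompact.isBounded.subset_closedBall 0
  -- The constraint |log p / 2| ≤ R, solved for p.
  refine ⟨Real.exp (-(2 * R)), Real.exp (2 * R), Real.exp_pos _, fun N p hp => ?_⟩
  have hp0 : 0 < p := by
    by_contra h
    exact hp (if_neg h)
  rw [logProfile_of_pos hp0] at hp
  have h1 := hR (subset_tsupport _ (right_ne_zero_of_mul hp))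
  rw [Metric.mem_closedBall, dist_zero_right, Real.norm_eq_abs, abs_le] at h1
  constructor
  · rw [← Real.le_log_iff_exp_le hp0]; linarith
  · rw [← Real.log_le_iff_le_exp hp0]; linarith

/-- Compact support of y confines the profile to an interval [c, C] with c > 0, so the singularities
of the power and the logarithm at p = 0 are never met. -/
theorem contDiff_logProfile (N : ℝ) {y : ℝ → ℝ} (hy : ContDiff ℝ ∞ y)
    (hyc : HasCompactSupport y) : ContDiff ℝ ∞ (logProfile N y) := by
  rw [contDiff_iff_contDiffAt]
  intro p
  obtain ⟨c, C, hc, h⟩ := exists_support_bound_logProfile hyc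
  rcases lt_or_ge p c with hp | hp
  · have : logProfile N y =ᶠ[𝓝 p] fun _ => 0 := by
      filter_upwards [Iio_mem_nhds hp] with q hq
      by_contra h'
      exact absurd (h N q h').1 (not_le.2 hq)
    exact contDiffAt_const.congr_of_eventuallyEq this
  · have hp0 := hc.trans_le hp
    refine ContDiffAt.congr_of_eventuallyEq ?_ (logProfile_eventuallyEq hp0)
    exact (Real.contDiffAt_rpow_const_of_ne hp0.ne').mul
      (hy.contDiffAt.comp p ((Real.contDiffAt_log.2 hp0.ne').neg.div_const 2))

theorem hasCompactSupport_logProfile (N : ℝ) {y : ℝ → ℝ} (hyc : HasCompactSupport y) :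
    HasCompactSupport (logProfile N y) := by
  obtain ⟨c, C, hc, h⟩ := exists_support_bound_logProfile hyc
  refine HasCompactSupport.intro (isCompact_Icc (a := c) (b := C)) fun p hp => ?_
  by_contra h'
  exact hp (h N p h')

theorem logProfile_normSq {n : ℕ} (k : ℕ) (y : ℝ → ℝ) {x : Space n} (hx : 0 < ‖x‖) :
    logProfile k y (‖x‖ ^ 2) = (‖x‖ ^ k)⁻¹ * y (-Real.log ‖x‖) := by
  rw [logProfile_of_pos (by positivity), Real.log_pow, ← Real.rpow_natCast, ← Real.rpow_mul hx.le,
    ← Real.rpow_natCast, ← Real.rpow_neg hx.le]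
  congr 2 <;> push_cast <;> ring

/-- On powers p^k the limit operator has indicial roots k = -N/2 and k = a = -N/2 + s. Factoring out
p^(-N/2) removes the zeroth-order term; in t the surviving solutions are 1 and e^(-2st). -/
theorem limitFormula_logProfile {N s p : ℝ} {y : ℝ → ℝ} (hy : ContDiff ℝ ∞ y) (hp : 0 < p) :
    limitFormula N (-N / 2 + s) (logProfile N y) p =
      logProfile (N + 2) (fun t => -deriv (deriv y) t - 2 * s * deriv y t) p := by
  have hy1 : ContDiff ℝ ∞ (deriv y) := (contDiff_infty_iff_deriv.1 hy).2
  have hd0 := hy.differentiable (by simp)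
  have hd1 := hy1.differentiable (by simp)
  have h1 : ∀ q, 0 < q → deriv (logProfile N y) q = q ^ (-N / 2 - 1) *
      (fun t => -N / 2 * y t - deriv y t / 2) (-Real.log q / 2) := fun q hq => by
    rw [(logProfile_eventuallyEq hq).deriv_eq]
    exact (hasDerivAt_rpow_mul_comp_log hq (hd0 _)).deriv
  have h2 : deriv (deriv (logProfile N y)) p = p ^ (-N / 2 - 1 - 1) *
      ((-N / 2 - 1) * (-N / 2 * y (-Real.log p / 2) - deriv y (-Real.log p / 2) / 2)
        - (-N / 2 * deriv y (-Real.log p / 2) - deriv (deriv y) (-Real.log p / 2) / 2) / 2) := by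
    have e : deriv (logProfile N y) =ᶠ[𝓝 p] fun q => q ^ (-N / 2 - 1) *
      (fun t => -N / 2 * y t - deriv y t / 2) (-Real.log q / 2) := by
      filter_upwards [Ioi_mem_nhds hp] with q hq using h1 q hq
    have hd : HasDerivAt (fun t => -N / 2 * y t - deriv y t / 2)
        (-N / 2 * deriv y (-Real.log p / 2) - deriv (deriv y) (-Real.log p / 2) / 2)
        (-Real.log p / 2) :=
      ((hd0 _).hasDerivAt.const_mul _).sub ((hd1 _).hasDerivAt.div_const 2)
    rw [e.deriv_eq, (hasDerivAt_rpow_mul_comp_log hp hd.differentiableAt).deriv, hd.deriv]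
  rw [limitFormula, h2, h1 p hp, logProfile_of_pos hp, logProfile_of_pos hp,
    show -(N + 2) / 2 = -N / 2 - 1 by ring, Real.rpow_sub_one hp.ne', Real.rpow_sub_one hp.ne']
  field_simp
  ring

/-- The dual equation tested with `x_N² |x|^(-N) y(-log |x|)`. -/
theorem integral_log_profile_eq {n : ℕ} {μ : ℝ} {ζ g : Space n → ℝ} {Z G : ℝ}
    (hζ : ContinuousOn ζ (halfSpace n)) (hZ : ∀ x ∈ halfSpace n, |ζ x| ≤ Z)
    (hg : IsDualOf n μ ζ g)
    (hG : ∀ᵐ x ∂(volume.restrict (halfSpace n)), |rho n x * g x| ≤ G)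
    {y : ℝ → ℝ} (hy : ContDiff ℝ ∞ y) (hyc : HasCompactSupport y) :
    ∫ x in halfSpace n, g x * (x (Fin.last n) ^ 2 * ((‖x‖ ^ (n + 1))⁻¹ * y (-Real.log ‖x‖))) =
      ∫ x in halfSpace n, ζ x * (x (Fin.last n) ^ 2 * ((‖x‖ ^ (n + 3))⁻¹ *
        (-deriv (deriv y) (-Real.log ‖x‖)
          - 2 * √(μ - muOne n) * deriv y (-Real.log ‖x‖)))) := by
  have hHm : MeasurableSet (halfSpace n) := (isOpen_halfSpace n).measurableSet
  have h := integral_sq_mul_normSq_eq hζ hZ hg hG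
    (contDiff_logProfile ((n + 1 : ℕ) : ℝ) hy hyc) (hasCompactSupport_logProfile _ hyc)
  rw [setIntegral_congr_fun hHm (g := fun x => g x * (x (Fin.last n) ^ 2 *
    ((‖x‖ ^ (n + 1))⁻¹ * y (-Real.log ‖x‖)))) fun x hx => by
      simp only [logProfile_normSq (n + 1) y (norm_pos_of_mem_halfSpace hx)]] at h
  rw [h]
  refine setIntegral_congr_fun hHm fun x hx => ?_
  have hx0 := norm_pos_of_mem_halfSpace hx
  have ha : alphaPlus n μ - 1 = -((n + 1 : ℕ) : ℝ) / 2 + √(μ - muOne n) := by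
    rw [alphaPlus]; push_cast; ring
  have hN : ((n : ℝ) + 1) = ((n + 1 : ℕ) : ℝ) := by push_cast; ring
  have hN2 : ((n + 1 : ℕ) : ℝ) + 2 = ((n + 3 : ℕ) : ℝ) := by push_cast; ring
  simp only [ha]
  rw [hN, limitFormula_logProfile hy (by positivity), hN2, logProfile_normSq _ _ hx0]

/-! ### Polar coordinates and concentration at the origin. -/

/-- The substitution r = e^(-t) turns dr/r into dt. -/
theorem integral_Ioi_inv_mul_comp_neg_log (Q : ℝ → ℝ) :
    ∫ r in Ioi (0 : ℝ), r⁻¹ * Q (-Real.log r) = ∫ t, Q t := by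
  have him : (fun t : ℝ => Real.exp (-t)) '' univ = Ioi 0 := by
    ext r
    simp only [image_univ, mem_range, mem_Ioi]
    constructor
    · rintro ⟨t, rfl⟩
      exact Real.exp_pos _
    · exact fun hr => ⟨-Real.log r, by rw [neg_neg, Real.exp_log hr]⟩
  have hd : ∀ t ∈ (univ : Set ℝ), HasDerivWithinAt (fun t : ℝ => Real.exp (-t))
      (-Real.exp (-t)) univ t := fun t _ => by
    have h : HasDerivAt (fun t : ℝ => Real.exp (-t)) _ t := (hasDerivAt_neg t).exp
    exact (h.congr_deriv (by ring)).hasDerivWithinAt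
  have hinj : InjOn (fun t : ℝ => Real.exp (-t)) univ := fun a _ b _ h => by
    have := Real.exp_injective h
    linarith
  rw [← him, integral_image_eq_integral_abs_deriv_smul MeasurableSet.univ hd hinj,
    setIntegral_univ]
  refine integral_congr_ae (Eventually.of_forall fun t => ?_)
  have := (Real.exp_pos (-t)).ne'
  simp only [abs_neg, abs_of_pos (Real.exp_pos (-t)), Real.log_exp, neg_neg, smul_eq_mul]
  field_simp

/-- Polar coordinates with `t = -log |x|`. -/
theorem integral_halfSpace_comp_neg_log (n : ℕ) (Q : ℝ → ℝ) :
    ∫ x in halfSpace n, x (Fin.last n) ^ 2 * ((‖x‖ ^ (n + 3))⁻¹ * Q (-Real.log ‖x‖)) =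
      psiOneSqIntegral n * ∫ t, Q t := by
  have hHm : MeasurableSet (halfSpace n) := (isOpen_halfSpace n).measurableSet
  set E := Space n
  have hfr : Module.finrank ℝ E - 1 = n := by simp [E]
  let μ : Measure E := volume
  let f : E → ℝ := (halfSpace n).indicator fun x =>
    x (Fin.last n) ^ 2 * ((‖x‖ ^ (n + 3))⁻¹ * Q (-Real.log ‖x‖))
  let A : Set (Metric.sphere (0 : E) 1) := {σ | (σ : E) ∈ halfSpace n}
  have hA : MeasurableSet A := measurable_subtype_coe hHm
  let F₁ : Metric.sphere (0 : E) 1 → ℝ := A.indicator fun σ => psiOne n (σ : E) ^ 2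
  -- Two of the n + 3 inverse powers go into ψ₁²; the Jacobian r^n then reduces the remaining n + 1
  -- to r⁻¹.
  let F₂ : Ioi (0 : ℝ) → ℝ := fun r => ((r : ℝ) ^ (n + 1))⁻¹ * Q (-Real.log r)
  have key : ∀ x : ({(0)}ᶜ : Set E), f x =
      F₁ (homeomorphUnitSphereProd E x).1 * F₂ (homeomorphUnitSphereProd E x).2 := by
    rintro ⟨x, hx⟩
    have hx0 : 0 < ‖x‖ := norm_pos_iff.2 hx
    have hc : ((homeomorphUnitSphereProd E ⟨x, hx⟩).1 : E) = ‖x‖⁻¹ • x := by simp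
    have hmem : (homeomorphUnitSphereProd E ⟨x, hx⟩).1 ∈ A ↔ x ∈ halfSpace n := by
      simp only [A, mem_ofPred_eq, hc]
      change 0 < ‖x‖⁻¹ * x (Fin.last n) ↔ 0 < x (Fin.last n)
      exact mul_pos_iff_of_pos_left (inv_pos.2 hx0)
    by_cases h : x ∈ halfSpace n
    · have h' := hmem.2 h
      simp only [f, F₁, F₂]
      rw [indicator_of_mem h, indicator_of_mem h', psiOne, hc, PiLp.smul_apply, smul_eq_mul,
        norm_smul, norm_inv, norm_norm, inv_mul_cancel₀ hx0.ne', div_one,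
        homeomorphUnitSphereProd_apply_snd_coe]
      field_simp
      ring
    · have h' := mt hmem.1 h
      simp only [f, F₁, F₂]
      rw [indicator_of_notMem h, indicator_of_notMem h', zero_mul]
  calc ∫ x in halfSpace n, x (Fin.last n) ^ 2 * ((‖x‖ ^ (n + 3))⁻¹ * Q (-Real.log ‖x‖))
      = ∫ x, f x ∂μ := (integral_indicator hHm).symm
    _ = ∫ x : ({(0)}ᶜ : Set E), f x ∂(μ.comap (↑)) := by
      rw [integral_subtype_comap (measurableSet_singleton _).compl f, restrict_compl_singleton]
    _ = ∫ q, F₁ q.1 * F₂ q.2 ∂μ.toSphere.prod (.volumeIoiPow (Module.finrank ℝ E - 1)) := by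
      rw [← μ.measurePreserving_homeomorphUnitSphereProd.integral_comp
        (Homeomorph.measurableEmbedding _)]
      exact integral_congr_ae (Eventually.of_forall key)
    _ = (∫ σ, F₁ σ ∂μ.toSphere) * ∫ r, F₂ r ∂(.volumeIoiPow n) := by
      rw [hfr, integral_prod_mul]
    _ = psiOneSqIntegral n * ∫ t, Q t := by
      congr 1
      · rw [integral_indicator hA]; rfl
      · rw [← integral_Ioi_inv_mul_comp_neg_log Q, Measure.volumeIoiPow]
        simp only [ENNReal.ofReal]
        rw [integral_withDensity_eq_integral_smul, integral_subtype_comap measurableSet_Ioi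
          fun r => Real.toNNReal (r ^ n) • ((r ^ (n + 1))⁻¹ * Q (-Real.log r))]
        · refine setIntegral_congr_fun measurableSet_Ioi fun r hr => ?_
          have hr' : (0 : ℝ) < r := hr
          simp only [NNReal.smul_def, Real.coe_toNNReal _ (pow_nonneg hr'.le n), smul_eq_mul]
          field_simp
          ring
        · exact (measurable_subtype_coe.pow_const _).real_toNNReal

/-- On the half-space the integrand agrees with a continuous compactly supported function, the
profile being extended by zero across the origin. -/
theorem integrable_log_profile (n k : ℕ) {Q : ℝ → ℝ} (hQ : ContDiff ℝ ∞ Q)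
    (hQc : HasCompactSupport Q) :
    IntegrableOn (fun x : Space n => x (Fin.last n) ^ 2 *
      ((‖x‖ ^ k)⁻¹ * Q (-Real.log ‖x‖))) (halfSpace n) := by
  have h : Integrable fun x : Space n => x (Fin.last n) ^ 2 * logProfile k Q (‖x‖ ^ 2) := by
    refine Continuous.integrable_of_hasCompactSupport ?_ ?_
    · have := (contDiff_logProfile (k : ℝ) hQ hQc).continuous
      have hcN : Continuous fun x : Space n => x (Fin.last n) := (lastCoord n).continuous
      fun_prop
    · exact (hasCompactSupport_comp_normSq (hasCompactSupport_logProfile _ hQc)).mul_left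
  refine h.integrableOn.congr_fun (fun x hx => ?_) (isOpen_halfSpace n).measurableSet
  simp only [logProfile_normSq k Q (norm_pos_of_mem_halfSpace hx)]

theorem psiOneSqIntegral_nonneg (n : ℕ) : 0 ≤ psiOneSqIntegral n :=
  integral_nonneg fun _ => sq_nonneg _

/-- Kernels of bounded mass in `t = -log |x|` escaping to `t = ∞` concentrate at the origin. -/
theorem tendsto_integral_log_kernel {n : ℕ} {ζ : Space n → ℝ} {Z C c : ℝ} {Q : ℕ → ℝ → ℝ}
    {T : ℕ → ℝ} (hζ : ContinuousOn ζ (closure (halfSpace n)))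
    (h0 : (0 : Space n) ∈ closure (halfSpace n)) (hZ : ∀ x ∈ halfSpace n, |ζ x| ≤ Z)
    (hQ : ∀ k, ContDiff ℝ ∞ (Q k)) (hQc : ∀ k, HasCompactSupport (Q k))
    (hT : Tendsto T atTop atTop) (hQT : ∀ k t, t < T k → Q k t = 0)
    (hC : ∀ k, ∫ t, |Q k t| ≤ C) (hc : ∀ k, ∫ t, Q k t = c) :
    Tendsto (fun k => ∫ x in halfSpace n, ζ x * (x (Fin.last n) ^ 2 *
      ((‖x‖ ^ (n + 3))⁻¹ * Q k (-Real.log ‖x‖)))) atTop (𝓝 (psiOneSqIntegral n * c * ζ 0)) := by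
  have hHm : MeasurableSet (halfSpace n) := (isOpen_halfSpace n).measurableSet
  have hC0 : 0 ≤ C := (integral_nonneg fun _ => abs_nonneg _).trans (hC 0)
  have hψ := psiOneSqIntegral_nonneg n
  set D := psiOneSqIntegral n * C with hD
  have hD0 : 0 ≤ D := mul_nonneg hψ hC0
  let W : ℕ → Space n → ℝ := fun k x => x (Fin.last n) ^ 2 *
      ((‖x‖ ^ (n + 3))⁻¹ * Q k (-Real.log ‖x‖))
  have hW : ∀ k, IntegrableOn (W k) (halfSpace n) := fun k =>
    integrable_log_profile n (n + 3) (hQ k) (hQc k)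
  have hWabs : ∀ k, ∫ x in halfSpace n, |W k x| ≤ D := by
    intro k
    have : ∀ x ∈ halfSpace n, |W k x| = x (Fin.last n) ^ 2 *
      ((‖x‖ ^ (n + 3))⁻¹ * |Q k (-Real.log ‖x‖)|) := fun x _ => by
      simp only [W]
      rw [abs_mul, abs_mul, abs_of_nonneg (sq_nonneg (x (Fin.last n))),
        abs_of_nonneg (by positivity : 0 ≤ (‖x‖ ^ (n + 3))⁻¹)]
    rw [setIntegral_congr_fun hHm this,
      integral_halfSpace_comp_neg_log n (fun t => |Q k t|)]
    exact mul_le_mul_of_nonneg_left (hC k) hψ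
  have hζm : AEStronglyMeasurable ζ (volume.restrict (halfSpace n)) :=
    (hζ.mono subset_closure).aestronglyMeasurable hHm
  have hζW : ∀ k, IntegrableOn (fun x => ζ x * W k x) (halfSpace n) := fun k =>
    (hW k).bdd_mul hζm ((ae_restrict_mem hHm).mono fun x hx => hZ x hx)
  rw [Metric.tendsto_atTop']
  intro ε hε
  -- Dividing by D + 1 covers D = 0. The margin 1 in the next line makes the kernel vanish wherever
  -- |x| ≥ δ, including |x| = δ.
  obtain ⟨δ, hδ, hδζ⟩ := Metric.continuousWithinAt_iff.1 (hζ 0 h0) (ε / (D + 1)) (by positivity)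
  obtain ⟨k₀, hk₀⟩ := eventually_atTop.1 (hT.eventually_ge_atTop (-Real.log δ + 1))
  refine ⟨k₀, fun k hk => ?_⟩
  have hTk := hk₀ k hk.le
  have e : (∫ x in halfSpace n, ζ x * W k x) - psiOneSqIntegral n * c * ζ 0 =
      ∫ x in halfSpace n, (ζ x - ζ 0) * W k x := by
    have h1 : ∫ x in halfSpace n, ζ 0 * W k x = psiOneSqIntegral n * c * ζ 0 := by
      rw [integral_const_mul, integral_halfSpace_comp_neg_log n (Q k), hc k]
      ring
    rw [← h1, ← integral_sub (hζW k) ((hW k).const_mul _)]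
    exact integral_congr_ae (Eventually.of_forall fun x => (sub_mul _ _ _).symm)
  change dist (∫ x in halfSpace n, ζ x * W k x) _ < ε
  rw [Real.dist_eq, e]
  calc |∫ x in halfSpace n, (ζ x - ζ 0) * W k x|
      ≤ ∫ x in halfSpace n, ε / (D + 1) * |W k x| := by
        rw [← Real.norm_eq_abs]
        refine norm_integral_le_of_norm_le ((hW k).abs.const_mul _) ?_
        filter_upwards [ae_restrict_mem hHm] with x hx
        rw [Real.norm_eq_abs, abs_mul]
        have hx0 := norm_pos_of_mem_halfSpace hx
        by_cases hxd : ‖x‖ < δ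
        · gcongr
          have := hδζ (subset_closure hx) (by simpa using hxd)
          exact this.le
        · have : W k x = 0 := by
            have : Real.log δ ≤ Real.log ‖x‖ := Real.log_le_log hδ (not_lt.1 hxd)
            simp only [W]
            rw [hQT k _ (by linarith)]
            ring
          simp [this]
    _ = ε / (D + 1) * ∫ x in halfSpace n, |W k x| := integral_const_mul _ _
    _ ≤ ε / (D + 1) * D := by gcongr; exact hWabs k
    _ < ε := by
        rw [div_mul_eq_mul_div, div_lt_iff₀ (by positivity)]
        nlinarith

/-! ### The truncation at t = ∞ and the source it creates. -/

/-- Smooth cutoff equal to `1` on `τ ≤ 1` and to `0` on `τ ≥ 2`. -/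
def cutoffAtTop (τ : ℝ) : ℝ := Real.smoothTransition (2 - τ)

theorem contDiff_cutoffAtTop : ContDiff ℝ ∞ cutoffAtTop :=
  Real.smoothTransition.contDiff.comp (contDiff_const.sub contDiff_id)

theorem cutoffAtTop_of_le_one {τ : ℝ} (h : τ ≤ 1) : cutoffAtTop τ = 1 :=
  Real.smoothTransition.one_of_one_le (by linarith)

theorem cutoffAtTop_of_two_le {τ : ℝ} (h : 2 ≤ τ) : cutoffAtTop τ = 0 :=
  Real.smoothTransition.zero_of_nonpos (by linarith)

theorem abs_cutoffAtTop_le (τ : ℝ) : |cutoffAtTop τ| ≤ 1 := by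
  rw [cutoffAtTop, abs_of_nonneg (Real.smoothTransition.nonneg _)]
  exact Real.smoothTransition.le_one _

theorem deriv_cutoffAtTop {τ : ℝ} (h : τ < 1 ∨ 2 < τ) : deriv cutoffAtTop τ = 0 := by
  rcases h with h | h
  · have : cutoffAtTop =ᶠ[𝓝 τ] fun _ => 1 := by
      filter_upwards [Iio_mem_nhds h] with t ht using cutoffAtTop_of_le_one (le_of_lt ht)
    rw [this.deriv_eq]; simp
  · have : cutoffAtTop =ᶠ[𝓝 τ] fun _ => 0 := by
      filter_upwards [Ioi_mem_nhds h] with t ht using cutoffAtTop_of_two_le (le_of_lt ht)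
    rw [this.deriv_eq]; simp

theorem deriv_deriv_cutoffAtTop {τ : ℝ} (h : τ < 1 ∨ 2 < τ) :
    deriv (deriv cutoffAtTop) τ = 0 := by
  have : deriv cutoffAtTop =ᶠ[𝓝 τ] fun _ => 0 := by
    rcases h with h | h
    · filter_upwards [Iio_mem_nhds h] with t ht using deriv_cutoffAtTop (Or.inl ht)
    · filter_upwards [Ioi_mem_nhds h] with t ht using deriv_cutoffAtTop (Or.inr ht)
  rw [this.deriv_eq]; simp

theorem contDiff_deriv_cutoffAtTop : ContDiff ℝ ∞ (deriv cutoffAtTop) :=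
  (contDiff_infty_iff_deriv.1 contDiff_cutoffAtTop).2

theorem contDiff_deriv_deriv_cutoffAtTop : ContDiff ℝ ∞ (deriv (deriv cutoffAtTop)) :=
  (contDiff_infty_iff_deriv.1 contDiff_deriv_cutoffAtTop).2

theorem exists_bound_cutoffAtTop : ∃ C : ℝ, 0 ≤ C ∧ (∀ τ, |deriv cutoffAtTop τ| ≤ C) ∧
    ∀ τ, |deriv (deriv cutoffAtTop) τ| ≤ C := by
  have s1 : HasCompactSupport (deriv cutoffAtTop) :=
    HasCompactSupport.intro (isCompact_Icc (a := (1 : ℝ)) (b := 2)) fun τ hτ =>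
      deriv_cutoffAtTop (by simpa [or_iff_not_imp_left] using hτ)
  obtain ⟨C₁, h₁⟩ := contDiff_deriv_cutoffAtTop.continuous.bounded_above_of_compact_support s1
  obtain ⟨C₂, h₂⟩ :=
    contDiff_deriv_deriv_cutoffAtTop.continuous.bounded_above_of_compact_support s1.deriv
  exact ⟨max C₁ C₂, le_max_of_le_left ((norm_nonneg _).trans (h₁ 0)),
    fun τ => (h₁ τ).trans (le_max_left _ _), fun τ => (h₂ τ).trans (le_max_right _ _)⟩

/-- The radial source `-y'' - 2 s y'` produced by `y(t) = (A + B t) χ(t / T)` when `s B = 0`. -/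
def cutoffSource (A B s T t : ℝ) : ℝ :=
  -2 * (B + s * A) * (deriv cutoffAtTop (t / T) / T)
    - (A + B * t) * (deriv (deriv cutoffAtTop) (t / T) / T ^ 2)

theorem hasDerivAt_cutoffAtTop_div (T t : ℝ) :
    HasDerivAt (fun t => cutoffAtTop (t / T)) (deriv cutoffAtTop (t / T) / T) t := by
  have h := ((contDiff_cutoffAtTop.differentiable (by simp)) (t / T)).hasDerivAt
  have h1 : HasDerivAt (fun t : ℝ => t / T) (1 / T) t := (hasDerivAt_id t).div_const T
  have h2 := HasDerivAt.comp t h h1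
  exact h2.congr_deriv (by ring)

theorem hasDerivAt_deriv_cutoffAtTop_div (T t : ℝ) :
    HasDerivAt (fun t => deriv cutoffAtTop (t / T) / T)
      (deriv (deriv cutoffAtTop) (t / T) / T ^ 2) t := by
  have h := ((contDiff_deriv_cutoffAtTop.differentiable (by simp)) (t / T)).hasDerivAt
  have h1 : HasDerivAt (fun t : ℝ => t / T) (1 / T) t := (hasDerivAt_id t).div_const T
  have h2 := (HasDerivAt.comp t h h1).div_const T
  exact h2.congr_deriv (by ring)

theorem hasDerivAt_affine (A B t : ℝ) : HasDerivAt (fun t => A + B * t) B t := by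
  have h : HasDerivAt (fun t => A + B * t) _ t := ((hasDerivAt_id t).const_mul B).const_add A
  exact h.congr_deriv (by ring)

theorem deriv_affine_mul_cutoff (A B T : ℝ) :
    deriv (fun t => (A + B * t) * cutoffAtTop (t / T)) = fun t =>
      B * cutoffAtTop (t / T) + (A + B * t) * (deriv cutoffAtTop (t / T) / T) := by
  funext t
  exact ((hasDerivAt_affine A B t).mul (hasDerivAt_cutoffAtTop_div T t)).deriv

theorem cutoffSource_eq {A B s : ℝ} (hsB : s * B = 0) (T t : ℝ) :
    -deriv (deriv fun t => (A + B * t) * cutoffAtTop (t / T)) t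
      - 2 * s * deriv (fun t => (A + B * t) * cutoffAtTop (t / T)) t = cutoffSource A B s T t := by
  have h : HasDerivAt (fun t => B * cutoffAtTop (t / T)
      + (A + B * t) * (deriv cutoffAtTop (t / T) / T)) _ t :=
    ((hasDerivAt_cutoffAtTop_div T t).const_mul B).add
      ((hasDerivAt_affine A B t).mul (hasDerivAt_deriv_cutoffAtTop_div T t))
  rw [deriv_affine_mul_cutoff, h.deriv, cutoffSource]
  linear_combination (-2 * cutoffAtTop (t / T) - 2 * t * (deriv cutoffAtTop (t / T) / T)) * hsB

theorem cutoffSource_eq_zero (A B s : ℝ) {T t : ℝ} (hT : 0 < T) (h : t < T ∨ 2 * T < t) :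
    cutoffSource A B s T t = 0 := by
  have h' : t / T < 1 ∨ 2 < t / T := h.imp (div_lt_one hT).2 (lt_div_iff₀ hT).2
  rw [cutoffSource, deriv_cutoffAtTop h', deriv_deriv_cutoffAtTop h']
  ring

theorem contDiff_cutoffSource (A B s T : ℝ) : ContDiff ℝ ∞ (cutoffSource A B s T) := by
  have h1 := contDiff_deriv_cutoffAtTop
  have h2 := contDiff_deriv_deriv_cutoffAtTop
  unfold cutoffSource
  fun_prop

theorem hasCompactSupport_cutoffSource (A B s : ℝ) {T : ℝ} (hT : 0 < T) :
    HasCompactSupport (cutoffSource A B s T) :=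
  HasCompactSupport.intro (isCompact_Icc (a := T) (b := 2 * T)) fun t ht =>
    cutoffSource_eq_zero A B s hT (by simpa [or_iff_not_imp_left] using ht)

/-- The source has the explicit primitive -(B + 2sA) χ(t/T) - (A + Bt) χ'(t/T)/T, which is -(B +
2sA) near -∞ and 0 near +∞. -/
theorem integral_cutoffSource (A B s : ℝ) {T : ℝ} (hT : 0 < T) :
    ∫ t, cutoffSource A B s T t = B + 2 * s * A := by
  have hd : ∀ t, HasDerivAt (fun t => -(B + 2 * s * A) * cutoffAtTop (t / T)
      - (A + B * t) * (deriv cutoffAtTop (t / T) / T)) (cutoffSource A B s T t) t := fun t => by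
    refine (((hasDerivAt_cutoffAtTop_div T t).const_mul (-(B + 2 * s * A))).sub
      ((hasDerivAt_affine A B t).mul (hasDerivAt_deriv_cutoffAtTop_div T t))).congr_deriv ?_
    rw [cutoffSource]
    ring
  have hint : Integrable (cutoffSource A B s T) :=
    (contDiff_cutoffSource A B s T).continuous.integrable_of_hasCompactSupport
      (hasCompactSupport_cutoffSource A B s hT)
  have hbot : Tendsto (fun t => -(B + 2 * s * A) * cutoffAtTop (t / T)
      - (A + B * t) * (deriv cutoffAtTop (t / T) / T)) atBot (𝓝 (-(B + 2 * s * A))) := by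
    refine tendsto_const_nhds.congr' ?_
    filter_upwards [Iio_mem_atBot T] with t ht
    have : t / T < 1 := (div_lt_one hT).2 ht
    rw [cutoffAtTop_of_le_one this.le, deriv_cutoffAtTop (Or.inl this)]
    ring
  have htop : Tendsto (fun t => -(B + 2 * s * A) * cutoffAtTop (t / T)
      - (A + B * t) * (deriv cutoffAtTop (t / T) / T)) atTop (𝓝 0) := by
    refine tendsto_const_nhds.congr' ?_
    filter_upwards [Ioi_mem_atTop (2 * T)] with t ht
    have : 2 < t / T := (lt_div_iff₀ hT).2 ht
    rw [cutoffAtTop_of_two_le this.le, deriv_cutoffAtTop (Or.inr this)]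
    ring
  rw [integral_of_hasDerivAt_of_tendsto hd hint hbot htop]
  ring

/-- The source is O(1/T) on an interval of length T: the growth A + Bt = O(T) is offset by the
factor T⁻² in front of χ''. -/
theorem exists_integral_abs_cutoffSource_le (A B s : ℝ) :
    ∃ C, ∀ T, 1 ≤ T → ∫ t, |cutoffSource A B s T t| ≤ C := by
  obtain ⟨C, hC, h1, h2⟩ := exists_bound_cutoffAtTop
  refine ⟨2 * |B + s * A| * C + (|A| + 2 * |B|) * C, fun T hT => ?_⟩
  have hT0 : 0 < T := by linarith
  rw [← setIntegral_eq_integral_of_forall_compl_eq_zero (s := Icc T (2 * T)) fun t ht => by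
    rw [cutoffSource_eq_zero A B s hT0 (by simpa [or_iff_not_imp_left] using ht), abs_zero]]
  have hb : ∀ t ∈ Icc T (2 * T), ‖|cutoffSource A B s T t|‖ ≤
      (2 * |B + s * A| * C + (|A| + 2 * |B|) * C) / T := by
    intro t ht
    have ht0 : 0 ≤ t := hT0.le.trans ht.1
    rw [Real.norm_eq_abs, abs_abs, cutoffSource]
    have hAB : |A + B * t| ≤ (|A| + 2 * |B|) * T := by
      calc |A + B * t| ≤ |A| + |B| * t := by
            refine (abs_add_le _ _).trans ?_
            rw [abs_mul, abs_of_nonneg ht0]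
        _ ≤ |A| * T + |B| * (2 * T) := by
            gcongr
            · exact le_mul_of_one_le_right (abs_nonneg _) hT
            · exact ht.2
        _ = _ := by ring
    calc _ ≤ |-2 * (B + s * A) * (deriv cutoffAtTop (t / T) / T)|
          + |(A + B * t) * (deriv (deriv cutoffAtTop) (t / T) / T ^ 2)| := abs_sub _ _
      _ = 2 * |B + s * A| * (|deriv cutoffAtTop (t / T)| / T)
          + |A + B * t| * (|deriv (deriv cutoffAtTop) (t / T)| / T ^ 2) := by
          rw [abs_mul, abs_mul, abs_mul, abs_div, abs_div, abs_of_pos hT0,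
            abs_of_pos (pow_pos hT0 2), abs_neg, abs_two]
      _ ≤ 2 * |B + s * A| * (C / T) + ((|A| + 2 * |B|) * T) * (C / T ^ 2) := by
          gcongr
          · exact h1 _
          · exact h2 _
      _ = _ := by field_simp
  have := norm_setIntegral_le_of_norm_le_const (μ := volume) (s := Icc T (2 * T))
    (by simp) hb
  rw [Real.norm_eq_abs] at this
  refine (le_abs_self _).trans (this.trans (le_of_eq ?_))
  rw [Real.volume_real_Icc_of_le (by linarith)]
  field_simp
  ring

/-! ### Uniqueness and locality of the distributional dual. -/

theorem IsDualOf.integrableOn_mul {n : ℕ} {μ : ℝ} {ζ g : Space n → ℝ} (hg : IsDualOf n μ ζ g)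
    {ξ : Space n → ℝ} (hξ : ContDiff ℝ ∞ ξ) (hξc : HasCompactSupport ξ)
    (hξs : tsupport ξ ⊆ halfSpace n) : IntegrableOn (fun x => g x * ξ x) (halfSpace n) := by
  have h1 : IntegrableOn (fun x => g x * ξ x) (tsupport ξ) :=
    (hg.1.integrableOn_compact_subset hξs hξc).mul_continuousOn hξ.continuous.continuousOn hξc
  have h2 : Integrable (fun x => g x * ξ x) :=
    (integrableOn_iff_integrable_of_support_subset
      ((Function.support_mul_subset_right _ _).trans (subset_tsupport ξ))).1 h1
  exact h2.integrableOn

theorem integral_smul_eq_setIntegral {n : ℕ} {ξ : Space n → ℝ} (hξs : tsupport ξ ⊆ halfSpace n)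
    (g : Space n → ℝ) : ∫ x, ξ x • g x = ∫ x in halfSpace n, g x * ξ x := by
  rw [← setIntegral_eq_integral_of_forall_compl_eq_zero (s := halfSpace n)]
  · simp only [smul_eq_mul, mul_comm]
  · intro x hx
    rw [image_eq_zero_of_notMem_tsupport fun h => hx (hξs h), zero_smul]

/-- By the fundamental lemma of the calculus of variations. It carries the bound on ρ g from the
representative supplied by `testSpace` to any other. -/
theorem IsDualOf.ae_eq {n : ℕ} {μ : ℝ} {ζ g g' : Space n → ℝ} (hg : IsDualOf n μ ζ g)
    (hg' : IsDualOf n μ ζ g') : ∀ᵐ x ∂(volume.restrict (halfSpace n)), g x = g' x := by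
  rw [ae_restrict_iff' (isOpen_halfSpace n).measurableSet]
  have := (isOpen_halfSpace n).ae_eq_zero_of_integral_contDiff_smul_eq_zero (hg.1.sub hg'.1)
    fun ξ h1 h2 h3 => by
      rw [integral_smul_eq_setIntegral h3]
      simp only [Pi.sub_apply, sub_mul]
      rw [integral_sub (hg.integrableOn_mul h1 h2 h3) (hg'.integrableOn_mul h1 h2 h3),
        ← hg.2 ξ h1 h2 h3, ← hg'.2 ξ h1 h2 h3, sub_self]
  filter_upwards [this] with x hx hxH using sub_eq_zero.1 (hx hxH)

/-- The dual operator is local: it vanishes where `ζ` does. -/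
theorem IsDualOf.ae_eq_zero {n : ℕ} {μ R : ℝ} {ζ g : Space n → ℝ} (hg : IsDualOf n μ ζ g)
    (hζ : ∀ x ∈ halfSpace n, R < ‖x‖ → ζ x = 0) :
    ∀ᵐ x ∂(volume.restrict (halfSpace n)), R < ‖x‖ → g x = 0 := by
  rw [ae_restrict_iff' (isOpen_halfSpace n).measurableSet]
  have hU : IsOpen (halfSpace n ∩ {x | R < ‖x‖}) :=
    (isOpen_halfSpace n).inter (isOpen_lt continuous_const continuous_norm)
  have := hU.ae_eq_zero_of_integral_contDiff_smul_eq_zero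
    (hg.1.mono_set inter_subset_left) fun ξ h1 h2 h3 => by
      have h4 := h3.trans inter_subset_left
      rw [integral_smul_eq_setIntegral h4, ← hg.2 ξ h1 h2 h4]
      refine setIntegral_eq_zero_of_forall_eq_zero fun x hx => ?_
      by_cases hxs : x ∈ tsupport ξ
      · rw [hζ x hx (h3 hxs).2, zero_mul]
      · rw [dualTranspose_eq_zero μ hxs, mul_zero]
  filter_upwards [this] with x hx hxH hxR using hx ⟨hxH, hxR⟩

/-! ### The density of φ_μ dγ_μ and its integrability. -/

/-- `φ_μ γ_μ = x_N² |x|^(-N) (A + B log (1/|x|))`, with `(A, B) = (1, 0)` off the critical value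
and `(A, B) = (0, 1)` at it. -/
theorem exists_phiFun_mul_gammaFun (n : ℕ) (μ : ℝ) : ∃ A B : ℝ,
    √(μ - muOne n) * B = 0 ∧
    psiOneSqIntegral n * (B + 2 * √(μ - muOne n) * A) = cConst n μ ∧
    ∀ x ∈ halfSpace n, phiFun n μ x * gammaFun n μ x =
      x (Fin.last n) ^ 2 * ((‖x‖ ^ (n + 1))⁻¹ * (A + B * -Real.log ‖x‖)) := by
  -- In both cases the radial exponents of φ_μ and γ_μ sum to 2 - N = 1 - n, so the product does not
  -- depend on s.
  have pow_eq : ∀ {r a b : ℝ}, 0 < r → a + b = 1 - n → r ^ a * r ^ b = r ^ 2 * (r ^ (n + 1))⁻¹ := by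
    intro r a b hr hab
    rw [← Real.rpow_add hr, hab, show (1 - n : ℝ) = (2 : ℕ) - (n + 1 : ℕ) by push_cast; ring,
      Real.rpow_sub hr, Real.rpow_natCast, Real.rpow_natCast, div_eq_mul_inv]
  by_cases h : μ = muOne n
  · refine ⟨0, 1, by simp [h], by simp [h, cConst], fun x hx => ?_⟩
    have hr := norm_pos_of_mem_halfSpace hx
    have e := pow_eq hr (a := -(((n : ℝ) + 1) - 2) / 2) (b := alphaPlus n μ)
      (by rw [alphaPlus, h, sub_self, Real.sqrt_zero]; ring)
    rw [phiFun, if_pos h, gammaFun, psiOne, Real.log_inv]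
    calc _ = (‖x‖ ^ (-(((n : ℝ) + 1) - 2) / 2) * ‖x‖ ^ alphaPlus n μ) * (-Real.log ‖x‖)
          * (x (Fin.last n) / ‖x‖) ^ 2 := by ring
      _ = _ := by rw [e]; field_simp; ring
  · refine ⟨1, 0, by simp, by simp [h, cConst]; ring, fun x hx => ?_⟩
    have hr := norm_pos_of_mem_halfSpace hx
    have e := pow_eq hr (a := alphaMinus n μ) (b := alphaPlus n μ)
      (by rw [alphaPlus, alphaMinus]; ring)
    rw [phiFun, if_neg h, gammaFun, psiOne]
    calc _ = (‖x‖ ^ alphaMinus n μ * ‖x‖ ^ alphaPlus n μ)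
          * (x (Fin.last n) / ‖x‖) ^ 2 := by ring
      _ = _ := by rw [e]; field_simp; ring

/-- The Jacobian r^n = r^(N-1) cancels the singular power exactly, leaving a logarithm that is
integrable at 0. -/
theorem integrableOn_ball_inv_pow_mul_log (n : ℕ) (A B R : ℝ) :
    IntegrableOn (fun x : Space n => (‖x‖ ^ n)⁻¹ * |A + B * -Real.log ‖x‖|) (Metric.ball 0 R) := by
  rw [integrableOn_fun_norm_addHaar volume (E := Space n)
    (f := fun r => (r ^ n)⁻¹ * |A + B * -Real.log r|)]
  have hfr : Module.finrank ℝ (Space n) - 1 = n := by simp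
  rw [hfr]
  have h : IntegrableOn (fun r : ℝ => |A + B * -Real.log r|) (Ioo 0 R) := by
    have h1 : IntervalIntegrable Real.log volume 0 R := intervalIntegral.intervalIntegrable_log'
    have h2 : IntegrableOn Real.log (Ioo 0 R) := h1.1.mono_set Ioo_subset_Ioc_self
    have h3 : IntegrableOn (fun _ : ℝ => A) (Ioo 0 R) := integrableOn_const (by simp)
    exact (h3.add (h2.neg.const_mul B)).abs
  refine h.congr_fun (fun r hr => ?_) measurableSet_Ioo
  have : (0 : ℝ) < r := hr.1
  simp only [smul_eq_mul]
  field_simp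

theorem measurable_gammaFun (n : ℕ) (μ : ℝ) : Measurable (gammaFun n μ) := by
  have : Measurable fun x : Space n => x (Fin.last n) := (lastCoord n).continuous.measurable
  unfold gammaFun psiOne
  fun_prop

theorem measurable_phiFun (n : ℕ) (μ : ℝ) : Measurable (phiFun n μ) := by
  have : Measurable fun x : Space n => x (Fin.last n) := (lastCoord n).continuous.measurable
  unfold phiFun psiOne
  split_ifs <;> fun_prop

theorem measurable_rho (n : ℕ) : Measurable (rho n) := (lastCoord n).continuous.measurable

theorem integrable_gammaMeasure_iff {n : ℕ} {μ : ℝ} {f : Space n → ℝ} :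
    Integrable f (gammaMeasure n μ) ↔
      IntegrableOn (fun x => gammaFun n μ x * f x) (halfSpace n) := by
  rw [gammaMeasure, integrable_withDensity_iff_integrable_smul'
    (measurable_gammaFun n μ).ennreal_ofReal (Eventually.of_forall fun _ => ENNReal.ofReal_lt_top)]
  refine integrable_congr ?_
  filter_upwards [ae_restrict_mem (isOpen_halfSpace n).measurableSet] with x hx
  rw [ENNReal.toReal_ofReal (gammaFun_pos μ hx).le, smul_eq_mul]

theorem integral_gammaMeasure {n : ℕ} {μ : ℝ} (f : Space n → ℝ) :
    ∫ x, f x ∂(gammaMeasure n μ) = ∫ x in halfSpace n, gammaFun n μ x * f x := by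
  rw [gammaMeasure, integral_withDensity_eq_integral_toReal_smul
    (measurable_gammaFun n μ).ennreal_ofReal (Eventually.of_forall fun _ => ENNReal.ofReal_lt_top)]
  refine integral_congr_ae ?_
  filter_upwards [ae_restrict_mem (isOpen_halfSpace n).measurableSet] with x hx
  rw [ENNReal.toReal_ofReal (gammaFun_pos μ hx).le, smul_eq_mul]

theorem sq_last_mul_inv_pow_le {n : ℕ} {x : Space n} (hx : x ∈ halfSpace n) :
    x (Fin.last n) * (‖x‖ ^ (n + 1))⁻¹ ≤ (‖x‖ ^ n)⁻¹ := by
  have hr := norm_pos_of_mem_halfSpace hx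
  calc x (Fin.last n) * (‖x‖ ^ (n + 1))⁻¹ ≤ ‖x‖ * (‖x‖ ^ (n + 1))⁻¹ := by
        gcongr; exact last_le_norm x
    _ = (‖x‖ ^ n)⁻¹ := by field_simp; ring

/-- Dividing φ_μ γ_μ by ρ leaves one factor x_N ≤ |x|, so the density is dominated by |x|^(1-N) |A +
Bt|. -/
theorem locallyIntegrable_phiFun (n : ℕ) (μ : ℝ) :
    LocallyIntegrable (phiFun n μ) (rhoInvGammaMeasure n μ) := by
  obtain ⟨A, B, -, -, hφ⟩ := exists_phiFun_mul_gammaFun n μ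
  have hHm := (isOpen_halfSpace n).measurableSet
  intro x₀
  refine ⟨Metric.ball 0 (‖x₀‖ + 1), Metric.isOpen_ball.mem_nhds (by simp), ?_⟩
  set R := ‖x₀‖ + 1
  have hbm : MeasurableSet (Metric.ball (0 : Space n) R) := measurableSet_ball
  rw [rhoInvGammaMeasure, gammaMeasure, IntegrableOn, restrict_withDensity hbm,
    restrict_withDensity hbm,
    integrable_withDensity_iff_integrable_smul' (f := fun x => ENNReal.ofReal (rho n x)⁻¹) (measurable_rho n).inv.ennreal_ofReal
      (Eventually.of_forall fun _ => ENNReal.ofReal_lt_top),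
    integrable_withDensity_iff_integrable_smul' (measurable_gammaFun n μ).ennreal_ofReal
      (Eventually.of_forall fun _ => ENNReal.ofReal_lt_top),
    Measure.restrict_restrict hbm]
  refine ((integrableOn_ball_inv_pow_mul_log n A B R).mono_set inter_subset_left).mono' ?_ ?_
  · have h1 := measurable_gammaFun n μ
    have h2 := measurable_rho n
    have h3 := measurable_phiFun n μ
    exact Measurable.aestronglyMeasurable (by fun_prop)
  · filter_upwards [ae_restrict_mem (hbm.inter hHm)] with x hx
    have hz : 0 < x (Fin.last n) := hx.2
    rw [ENNReal.toReal_ofReal (gammaFun_pos μ hx.2).le,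
      ENNReal.toReal_ofReal (inv_nonneg.2 hz.le : 0 ≤ (rho n x)⁻¹), smul_eq_mul, smul_eq_mul,
      show gammaFun n μ x * ((rho n x)⁻¹ * phiFun n μ x)
        = (rho n x)⁻¹ * (phiFun n μ x * gammaFun n μ x) by ring, hφ x hx.2, rho,
      show (x (Fin.last n))⁻¹ * (x (Fin.last n) ^ 2 * ((‖x‖ ^ (n + 1))⁻¹
        * (A + B * -Real.log ‖x‖))) = (x (Fin.last n) * (‖x‖ ^ (n + 1))⁻¹)
        * (A + B * -Real.log ‖x‖) by field_simp, Real.norm_eq_abs, abs_mul,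
      abs_of_nonneg (by positivity : 0 ≤ x (Fin.last n) * (‖x‖ ^ (n + 1))⁻¹)]
    exact mul_le_mul_of_nonneg_right (sq_last_mul_inv_pow_le hx.2) (abs_nonneg _)

/-- One factor x_N is spent on the bound for ρ g, the other lowers the singularity to |x|^(1-N), and
vanishing of g far out makes local integrability enough. -/
theorem integrableOn_mul_log_profile {n : ℕ} {g : Space n → ℝ} {G R : ℝ} (A B : ℝ)
    (hgm : AEStronglyMeasurable g (volume.restrict (halfSpace n)))
    (hG : ∀ᵐ x ∂(volume.restrict (halfSpace n)), |rho n x * g x| ≤ G)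
    (hR : ∀ᵐ x ∂(volume.restrict (halfSpace n)), R < ‖x‖ → g x = 0) :
    IntegrableOn (fun x => g x * (x (Fin.last n) ^ 2 * ((‖x‖ ^ (n + 1))⁻¹ *
      (A + B * -Real.log ‖x‖)))) (halfSpace n) := by
  have hHm := (isOpen_halfSpace n).measurableSet
  -- Radius R + 1, because the open ball of radius R misses the sphere |x| = R, where g need not
  -- vanish.
  have hb := (integrable_indicator_iff measurableSet_ball).2
    ((integrableOn_ball_inv_pow_mul_log n A B (R + 1)).const_mul G)
  refine Integrable.mono' (hb.mono_measure Measure.restrict_le_self) ?_ ?_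
  · have : Measurable fun x : Space n => x (Fin.last n) := (lastCoord n).continuous.measurable
    exact hgm.mul (Measurable.aestronglyMeasurable (by fun_prop))
  · filter_upwards [hG, hR, ae_restrict_mem hHm] with x hGx hRx hx
    have hz : 0 < x (Fin.last n) := hx
    by_cases hxR : R < ‖x‖
    · rw [hRx hxR, zero_mul, norm_zero]
      refine indicator_nonneg (fun y _ => ?_) x
      have := (abs_nonneg _).trans hGx
      positivity
    · rw [indicator_of_mem (by simp; linarith)]
      rw [rho, abs_mul, abs_of_pos hz] at hGx
      rw [Real.norm_eq_abs, abs_mul, abs_mul, abs_mul, abs_of_nonneg (sq_nonneg (x (Fin.last n))),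
        abs_of_nonneg (by positivity : 0 ≤ (‖x‖ ^ (n + 1))⁻¹)]
      calc _ = (x (Fin.last n) * |g x|) * ((x (Fin.last n) * (‖x‖ ^ (n + 1))⁻¹)
            * |A + B * -Real.log ‖x‖|) := by ring
        _ ≤ G * ((‖x‖ ^ n)⁻¹ * |A + B * -Real.log ‖x‖|) := by
            gcongr
            · exact (by positivity : 0 ≤ x (Fin.last n) * |g x|).trans hGx
            · exact sq_last_mul_inv_pow_le hx

theorem zero_mem_closure_halfSpace (n : ℕ) : (0 : Space n) ∈ closure (halfSpace n) := by
  have h : Tendsto (fun t : ℝ => t • (EuclideanSpace.single (Fin.last n) 1 : Space n)) (𝓝[>] 0)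
      (𝓝 0) := by
    have : Continuous fun t : ℝ => t • (EuclideanSpace.single (Fin.last n) 1 : Space n) := by
      fun_prop
    simpa using (this.tendsto 0).mono_left nhdsWithin_le_nhds
  refine mem_closure_of_tendsto h ?_
  filter_upwards [self_mem_nhdsWithin] with t ht
  simpa [halfSpace] using ht

/-! ### The representation formula. -/

/-- The representation formula, in terms of the explicit density of `φ_μ dγ_μ`. -/
theorem integral_mul_log_profile_eq {n : ℕ} {μ : ℝ} {ζ g : Space n → ℝ} {Z G R A B : ℝ}
    (hζ : ContinuousOn ζ (closure (halfSpace n))) (hZ : ∀ x ∈ halfSpace n, |ζ x| ≤ Z)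
    (hζR : ∀ x ∈ halfSpace n, R < ‖x‖ → ζ x = 0) (hg : IsDualOf n μ ζ g)
    (hG : ∀ᵐ x ∂(volume.restrict (halfSpace n)), |rho n x * g x| ≤ G)
    (hsB : √(μ - muOne n) * B = 0) :
    ∫ x in halfSpace n, g x * (x (Fin.last n) ^ 2 * ((‖x‖ ^ (n + 1))⁻¹ *
      (A + B * -Real.log ‖x‖))) =
      psiOneSqIntegral n * (B + 2 * √(μ - muOne n) * A) * ζ 0 := by
  have hHm := (isOpen_halfSpace n).measurableSet
  set s := √(μ - muOne n)
  -- The maximum with 1 keeps the logarithm meaningful when R ≤ 0.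
  set L := Real.log (max R 1)
  have hlogL : ∀ x ∈ halfSpace n, ¬ R < ‖x‖ → -L ≤ -Real.log ‖x‖ := fun x hx h =>
    neg_le_neg (Real.log_le_log (norm_pos_of_mem_halfSpace hx)
      ((not_lt.1 h).trans (le_max_left _ _)))
  have hgm : AEStronglyMeasurable g (volume.restrict (halfSpace n)) := hg.1.aestronglyMeasurable
  have hgR := hg.ae_eq_zero hζR
  let T : ℕ → ℝ := fun k => k + 1
  have hT : ∀ k, 1 ≤ T k := fun k => by simp [T]
  have hT0 : ∀ k, 0 < T k := fun k => one_pos.trans_le (hT k)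
  have hTt : Tendsto T atTop atTop :=
    tendsto_atTop_add_const_right _ 1 tendsto_natCast_atTop_atTop
  -- Cutoff at large |x|. It equals 1 on t > -L - 1, an open set containing every t with |x| ≤ R, so
  -- it does not affect derivatives there.
  let θ : ℝ → ℝ := fun t => Real.smoothTransition (t + L + 2)
  have hθ1 : ∀ t, -L - 1 < t → θ t = 1 := fun t ht =>
    Real.smoothTransition.one_of_one_le (by linarith)
  let w : ℕ → ℝ → ℝ := fun k t => (A + B * t) * cutoffAtTop (t / T k)
  let y : ℕ → ℝ → ℝ := fun k t => w k t * θ t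
  have hθs : ContDiff ℝ ∞ θ := Real.smoothTransition.contDiff.comp (by fun_prop)
  have hy : ∀ k, ContDiff ℝ ∞ (y k) := fun k => by
    have := contDiff_cutoffAtTop
    simp only [y, w]
    fun_prop
  have hyc : ∀ k, HasCompactSupport (y k) := fun k => by
    refine HasCompactSupport.intro (isCompact_Icc (a := -L - 2) (b := 2 * T k)) fun t ht => ?_
    rw [mem_Icc, not_and_or, not_le, not_le] at ht
    rcases ht with ht | ht
    · simp only [y, θ]
      rw [Real.smoothTransition.zero_of_nonpos (by linarith), mul_zero]
    · simp only [y, w]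
      rw [cutoffAtTop_of_two_le ((le_div_iff₀ (hT0 k)).2 ht.le)]
      ring
  have hyw : ∀ k t, -L - 1 < t → y k =ᶠ[𝓝 t] w k := fun k t ht => by
    filter_upwards [Ioi_mem_nhds ht] with u hu
    simp only [y]
    rw [hθ1 u hu, mul_one]
  have hR : ∀ k, ∫ x in halfSpace n, g x * (x (Fin.last n) ^ 2 * ((‖x‖ ^ (n + 1))⁻¹ *
      y k (-Real.log ‖x‖))) = ∫ x in halfSpace n, ζ x * (x (Fin.last n) ^ 2 *
      ((‖x‖ ^ (n + 3))⁻¹ * cutoffSource A B s (T k) (-Real.log ‖x‖))) := by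
    intro k
    rw [integral_log_profile_eq (hζ.mono subset_closure) hZ hg hG (hy k) (hyc k)]
    refine setIntegral_congr_fun hHm fun x hx => ?_
    -- Where θ may contribute, ζ = 0; elsewhere y and its uncut version w agree near t, so their
    -- derivatives do.
    by_cases hxR : R < ‖x‖
    · simp only [hζR x hx hxR, zero_mul]
    · have ht : -L - 1 < -Real.log ‖x‖ := by linarith [hlogL x hx hxR]
      have e1 := (hyw k _ ht).deriv_eq
      have e2 := (hyw k _ ht).deriv.deriv_eq
      simp only [e1, e2]
      rw [← cutoffSource_eq hsB]
  obtain ⟨C, hC⟩ := exists_integral_abs_cutoffSource_le A B s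
  have hlim := tendsto_integral_log_kernel (C := C) hζ (zero_mem_closure_halfSpace n) hZ
    (fun k => contDiff_cutoffSource A B s (T k))
    (fun k => hasCompactSupport_cutoffSource A B s (hT0 k)) hTt
    (fun k t ht => cutoffSource_eq_zero A B s (hT0 k) (Or.inl ht)) (fun k => hC _ (hT k))
    (fun k => integral_cutoffSource A B s (hT0 k))
  simp only [← hR] at hlim
  refine tendsto_nhds_unique ?_ hlim
  refine tendsto_integral_of_dominated_convergence
    (fun x => |g x * (x (Fin.last n) ^ 2 * ((‖x‖ ^ (n + 1))⁻¹ * (A + B * -Real.log ‖x‖)))|)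
    (fun k => ?_) (integrableOn_mul_log_profile A B hgm hG hgR).abs (fun k => ?_) ?_
  · have h1 : Measurable fun x : Space n => x (Fin.last n) := (lastCoord n).continuous.measurable
    have h2 := (hy k).continuous.measurable
    exact hgm.mul (Measurable.aestronglyMeasurable (by fun_prop))
  · refine Eventually.of_forall fun x => ?_
    rw [Real.norm_eq_abs, show g x * (x (Fin.last n) ^ 2 * ((‖x‖ ^ (n + 1))⁻¹ *
      y k (-Real.log ‖x‖))) = (g x * (x (Fin.last n) ^ 2 * ((‖x‖ ^ (n + 1))⁻¹ *
      (A + B * -Real.log ‖x‖)))) * (cutoffAtTop (-Real.log ‖x‖ / T k) * θ (-Real.log ‖x‖)) by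
        simp only [y, w]; ring, abs_mul _ (_ * θ _), abs_mul (cutoffAtTop _)]
    refine mul_le_of_le_one_right (abs_nonneg _)
      (mul_le_one₀ (abs_cutoffAtTop_le _) (abs_nonneg _) ?_)
    rw [abs_of_nonneg (Real.smoothTransition.nonneg _)]
    exact Real.smoothTransition.le_one _
  · filter_upwards [hgR, ae_restrict_mem hHm] with x hx hxH
    by_cases hxR : R < ‖x‖
    · simp only [hx hxR, zero_mul]
      exact tendsto_const_nhds
    · have ht : -L - 1 < -Real.log ‖x‖ := by linarith [hlogL x hxH hxR]
      refine tendsto_const_nhds.congr' ?_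
      filter_upwards [hTt.eventually_ge_atTop (-Real.log ‖x‖)] with k hk
      simp only [y, w]
      rw [hθ1 _ ht, cutoffAtTop_of_le_one ((div_le_one (hT0 k)).2 hk), mul_one, mul_one]

end

theorem proposition2p1 (n : ℕ) (hn : 1 ≤ n) (μ : ℝ) (hμ : muOne n ≤ μ) :
    LocallyIntegrableOn (phiFun n μ) (closure (halfSpace n)) (rhoInvGammaMeasure n μ) ∧
    ∀ ζ ∈ testSpace n μ, ∀ g : Space n → ℝ, IsDualOf n μ ζ g →
      Integrable (fun x => phiFun n μ x * g x) (gammaMeasure n μ) ∧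
      ∫ x, phiFun n μ x * g x ∂(gammaMeasure n μ) = cConst n μ * ζ 0 := by
  refine ⟨(locallyIntegrable_phiFun n μ).locallyIntegrableOn _, ?_⟩
  rintro ζ ⟨hζ, ⟨K, hK, hζK⟩, g₀, hg₀, hb⟩ g hg
  have hHm := (isOpen_halfSpace n).measurableSet
  obtain ⟨A, B, hsB, hc, hφ⟩ := exists_phiFun_mul_gammaFun n μ
  obtain ⟨R, hR⟩ := hK.isBounded.subset_closedBall 0
  have hζR : ∀ x ∈ halfSpace n, R < ‖x‖ → ζ x = 0 := fun x hx hxR =>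
    hζK x ⟨subset_closure hx, fun h => by simpa using (hR h).trans_lt hxR⟩
  obtain ⟨Z, hZ⟩ := (hK.inter_right isClosed_closure).exists_bound_of_continuousOn
    (hζ.mono inter_subset_right)
  have hZ' : ∀ x ∈ halfSpace n, |ζ x| ≤ max Z 0 := fun x hx => by
    by_cases hxK : x ∈ K
    · exact le_max_of_le_left (hZ x ⟨hxK, subset_closure hx⟩)
    · rw [hζK x ⟨subset_closure hx, hxK⟩, abs_zero]
      exact le_max_right _ _
  -- The essential bound is known for g₀ and passes to g by almost-everywhere uniqueness of the
  -- dual.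
  obtain ⟨G, hG⟩ : ∃ G, ∀ᵐ x ∂(volume.restrict (halfSpace n)), |rho n x * g x| ≤ G := by
    refine ⟨lpNorm (fun x => rho n x * g₀ x) ⊤ (volume.restrict (halfSpace n)), ?_⟩
    filter_upwards [hg.ae_eq hg₀, ae_le_lpNorm_exponent_top hb] with x h1 h2
    rw [h1]
    exact h2
  have hgm : AEStronglyMeasurable g (volume.restrict (halfSpace n)) := hg.1.aestronglyMeasurable
  have e : ∀ x ∈ halfSpace n, gammaFun n μ x * (phiFun n μ x * g x) =
      g x * (x (Fin.last n) ^ 2 * ((‖x‖ ^ (n + 1))⁻¹ * (A + B * -Real.log ‖x‖))) :=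
    fun x hx => by rw [← hφ x hx]; ring
  constructor
  · rw [integrable_gammaMeasure_iff]
    exact (integrableOn_mul_log_profile A B hgm hG (hg.ae_eq_zero hζR)).congr_fun
      (fun x hx => (e x hx).symm) hHm
  · rw [integral_gammaMeasure, setIntegral_congr_fun hHm e,
      integral_mul_log_profile_eq hζ hZ' hζR hg hG hsB, hc]
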